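/- **Asymptotics for Multinomial Logistic Regression.** Fix $\mathcal T\ge 1$, $p_{\min}>0$, $\mathcal X>0$, $\delta>0$. For each $n$ let $P_n$ be a law of $(X,D)$ with $D\in\{0,\dots,\mathcal T\}$, propensity scores $p_t(x)=P_n(D=t\mid X=x)\ge p_{\min}$ for all $t$ (almost every $x$), and let $X^*=R_n(X)\in\mathbb R^{p}$, $p=p_n$, satisfy $\max_j|X^*_j|\le\mathcal X$ a.s. Observe an i.i.d. sample $(x_i,d_i)_{i\le n}$ from $P_n$ and write $x_i^*=R_n(x_i)$, $\mathbb E_n[w_i]=n^{-1}\sum_{i\le n} w_i$. For $w\in\mathbb R^{\mathcal T}$ put $\hat p_t(w)=e^{w_t}/(1+\sum_{u=1}^{\mathcal T}e^{w_u})$; for $\gamma=(\gamma_1,\dots,\gamma_{\mathcal T})\in\mathbb R^{p\mathcal T}$ put $\hat p_t(x_i;\gamma)=\hat p_t((x_i^{*\prime}\gamma_u)_{u\le\mathcal T})$, $|||\gamma_{\cdot,S}|||=\sum_{j\in S}\|\gamma_{\cdot,j}\|_2$, $|||\gamma|||=|||\gamma_{\cdot,\{1,\dots,p\}}|||$, and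 $\mathrm{supp}(\gamma)=\{j:\|\gamma_{\cdot,j}\|_2>0\}$. Let $$\mathcal M(\gamma)=\mathbb E_n\Big[\log\Big(1+\sum_{t=1}^{\mathcal T} e^{x_i^{*\prime}\gamma_t}\Big)-\sum_{t=1}^{\mathcal T}1\{d_i=t\}\,x_i^{*\prime}\gamma_t\Big],\qquad \lambda_D=\frac{2\mathcal X\sqrt{\mathcal T}}{\sqrt n}\Big(1+\frac{\log(p\vee n)^{3/2+\delta}}{\sqrt{\mathcal T}}\Big)^{1/2}.$$ Let $\gamma^*=\gamma^*_n$ be coefficients with $S_*=\mathrm{supp}(\gamma^*)$, $|S_*|=s_d$, and let $b_s^d$ be such that, with probability approaching one (w.p.a.1), $\mathbb E_n[(\hat p_t(x_i;\gamma^*)-p_t(x_i))^2]^{1/2}\le b_s^d$ for $1\le t\le \mathcal T$. Let $\tilde\gamma$ be any minimizer of $\mathcal M(\gamma)+\lambda_D|||\gamma|||$ and $\tilde S^D=\mathrm{supp}(\tilde\gamma)$. Let $Q=\mathbb E_n[x_i^*x_i^{*\prime}]$. Write $\underline\phi\{Q,S\}^2$ and $\overline\phi\{Q,S\}^2$ for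 the minimum and maximum of $v'Qv/\|v\|_2^2$ over $v\ne0$ supported in $S$, and $\overline{\overline\phi}(Q,m)=\max_{|S|\le m}\overline\phi\{Q,S\}$. Assume: (i) $\lambda_D s_d=o(1)$ and $b_s^d\sqrt{s_d}=o(1)$; (ii) there are $\kappa_D=\kappa_{D,n}$, bounded away from zero, such that w.p.a.1 $\kappa_D^2\le\sum_t\delta_t'Q\delta_t/\|\delta_{\cdot,S_*}\|_2^2$ for all $\delta\in\mathbb R^{p\mathcal T}\setminus\{0\}$ with $|||\delta_{\cdot,S_*^c}|||\le4|||\delta_{\cdot,S_*}|||$; (iii) for every $C>0$ there is $c>0$ such that w.p.a.1 $\underline\phi\{Q,S\}\ge c$ for all nonempty $S$ with $|S|\le Cs_d$; and, for some fixed $A_K>2$, there is $C$ such that w.p.a.1 $\overline{\overline\phi}(Q,m)\le C$ for all $m\in\mathbb N_Q^D=\{m\in\{1,\dots,n\}:m>8s_dL_n\overline{\overline\phi}(Q,m)\}$, where $A_p=p_{\min}/(0\vee(p_{\min}-b_s^d))$, $R_{\mathcal M}=(A_p/p_{\min})^{\mathcal T+1}\mathcal T A_K(6\lambda_D\sqrt{s_d}/\kappa_D+8b_s^d\sqrt{\mathcal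 T})$ and $L_n=\mathcal T\big((R_{\mathcal M}+b_s^d)/(\lambda_D\sqrt{s_d})\big)^2$. Then: 1. If $b_s^d=O(\lambda_D\sqrt{s_d})$, then $|\tilde S^D|=O_{P_n}(s_d)$. Moreover, let $\hat S^D$ be any (data-dependent, possibly additionally random) sets of covariates and $\hat\gamma$ coefficients such that w.p.a.1 $\hat S^D\supseteq\tilde S^D$ and $\hat\gamma$ minimizes $\mathcal M$ over the $\gamma$ with $\mathrm{supp}(\gamma)\subseteq\hat S^D$. Suppose that either $|\hat S^D|=O_{P_n}(s_d)$, or $b_s^d=O(\lambda_D\sqrt{s_d})$ and $|\hat S^D\setminus\tilde S^D|=O_{P_n}(s_d)$. Then for each $t\in\{1,\dots,\mathcal T\}$: 2. $\mathbb E_n[(\hat p_t(x_i;\hat\gamma)-p_t(x_i))^2]=O_{P_n}\big(n^{-1}s_d\log(p\vee n)^{3/2+\delta}+(b_s^d)^2\big)$; 3. $\|\hat\gamma_t-\gamma^*_t\|_1=O_{P_n}\big(\sqrt{n^{-1}s_d^2\log(p\vee n)^{3/2+\delta}}+b_s^d\sqrt{s_d}\big)$. -/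

import Mathlib

open MeasureTheory ProbabilityTheory Filter Topology Asymptotics

namespace GroupLassoMLogit

noncomputable section

/-! ### Asymptotic notation along a sequence of probability spaces -/

/-- The events `E n` hold with probability approaching one. -/
def WPA1 {Ω : ℕ → Type*} [∀ n, MeasurableSpace (Ω n)] (μ : ∀ n, Measure (Ω n))
    (E : ∀ n, Set (Ω n)) : Prop :=
  Tendsto (fun n => μ n (E n)ᶜ) atTop (𝓝 0)

/-- `X n = O_{P_n}(a n)`: for each `ε > 0` there is `M` with
`P_n(|X n| > M * a n) ≤ ε` for all large `n`. -/
def IsOP {Ω : ℕ → Type*} [∀ n, MeasurableSpace (Ω n)] (μ : ∀ n, Measure (Ω n))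
    (X : ∀ n, Ω n → ℝ) (a : ℕ → ℝ) : Prop :=
  ∀ ε : ℝ, 0 < ε → ∃ M : ℝ, 0 < M ∧
    ∀ᶠ n in atTop, μ n {ω | M * a n < |X n ω|} ≤ ENNReal.ofReal ε

/-! ### Propensity scores

Treatments are `Fin (T + 1)`, with `0` the baseline; the treatments `1, …, T` are
`t.succ` for `t : Fin T`. -/

/-- The propensity score `p_t(x) = P(D = t | X = x)` of the law `P` of `(X, D)`. -/
def propensity {𝓧 : Type*} [MeasurableSpace 𝓧] {T : ℕ} (P : Measure (𝓧 × Fin (T + 1)))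
    [IsFiniteMeasure P] (t : Fin (T + 1)) (x : 𝓧) : ℝ :=
  (P.condKernel x).real {t}

/-- The multinomial logit function `exp (w_t) / (1 + ∑_u exp (w_u))`, `t = 1, …, T`. -/
def mlogit {T : ℕ} (w : Fin T → ℝ) (t : Fin T) : ℝ :=
  Real.exp (w t) / (1 + ∑ u, Real.exp (w u))

/-! ### Sample quantities

`x i j` is the `j`-th covariate of observation `i`, `d i` its treatment, and a coefficient
collection is `γ : Fin T → Fin p → ℝ`. -/

/-- The empirical mean `𝔼_n[f_i]`. -/
def empMean {n : ℕ} (f : Fin n → ℝ) : ℝ := (∑ i, f i) / n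

/-- The fitted log-odds `(x_i' γ_t)_t`. -/
def logOdds {T p : ℕ} (γ : Fin T → Fin p → ℝ) (xi : Fin p → ℝ) : Fin T → ℝ :=
  fun t => ∑ j, xi j * γ t j

/-- The multinomial logistic loss (average negative log-likelihood)
`𝔼_n[log (1 + ∑_t exp (x_i' γ_t)) - ∑_t 1{d_i = t} x_i' γ_t]`. -/
def mlogitLoss {n T p : ℕ} (x : Fin n → Fin p → ℝ) (d : Fin n → Fin (T + 1))
    (γ : Fin T → Fin p → ℝ) : ℝ :=
  empMean fun i =>
    Real.log (1 + ∑ t, Real.exp (logOdds γ (x i) t))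
      - ∑ t : Fin T, if d i = t.succ then logOdds γ (x i) t else 0

/-- The mixed `ℓ₂/ℓ₁` norm of `δ_{·,S}`: outer sum over covariates in `S`, inner Euclidean norm
over treatments. -/
def mixedNormOn {T p : ℕ} (S : Finset (Fin p)) (δ : Fin T → Fin p → ℝ) : ℝ :=
  ∑ j ∈ S, Real.sqrt (∑ t, δ t j ^ 2)

/-- The union over treatments of the supports, `{j : ‖γ_{·,j}‖₂ > 0}`. -/
def suppUnion {T p : ℕ} (γ : Fin T → Fin p → ℝ) : Finset (Fin p) :=
  {j | 0 < Real.sqrt (∑ t, γ t j ^ 2)}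

/-- `γ` is a group lasso estimate with penalty level `lam`. -/
def IsGroupLasso {n T p : ℕ} (x : Fin n → Fin p → ℝ) (d : Fin n → Fin (T + 1)) (lam : ℝ)
    (γ : Fin T → Fin p → ℝ) : Prop :=
  ∀ γ' : Fin T → Fin p → ℝ,
    mlogitLoss x d γ + lam * mixedNormOn Finset.univ γ
      ≤ mlogitLoss x d γ' + lam * mixedNormOn Finset.univ γ'

/-- `γ` is an unpenalized multinomial logistic fit using the covariates in `S`. -/
def IsRefit {n T p : ℕ} (x : Fin n → Fin p → ℝ) (d : Fin n → Fin (T + 1)) (S : Finset (Fin p))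
    (γ : Fin T → Fin p → ℝ) : Prop :=
  suppUnion γ ⊆ S ∧
    ∀ γ' : Fin T → Fin p → ℝ, suppUnion γ' ⊆ S → mlogitLoss x d γ ≤ mlogitLoss x d γ'

/-- The penalty level
`λ = (2 𝒳 √T / √n) (1 + log(p ∨ n)^(3/2 + δ) / √T)^(1/2)`. -/
def penalty (xbar δ : ℝ) (T n p : ℕ) : ℝ :=
  2 * xbar * Real.sqrt T / Real.sqrt n *
    Real.sqrt (1 + Real.log (max p n : ℕ) ^ (3 / 2 + δ) / Real.sqrt T)

/-! ### Gram matrix, restricted and sparse eigenvalues -/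

/-- The empirical Gram matrix `Q = 𝔼_n[x_i x_i']`. -/
def gram {n p : ℕ} (x : Fin n → Fin p → ℝ) : Matrix (Fin p) (Fin p) ℝ :=
  fun j k => empMean fun i => x i j * x i k

/-- The quadratic form `δ' Q δ`. -/
def quadForm {p : ℕ} (Q : Matrix (Fin p) (Fin p) ℝ) (δ : Fin p → ℝ) : ℝ :=
  ∑ j, ∑ k, δ j * Q j k * δ k

/-- `κ² ≤ min (∑_t δ_t' Q δ_t) / ‖δ_{·,S}‖₂²` over nonzero `δ` in the cone
`|||δ_{·,Sᶜ}||| ≤ 4 |||δ_{·,S}|||` (on which `δ_{·,S} ≠ 0`). -/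
def IsRestrictedEigenvalue {p : ℕ} (T : ℕ) (Q : Matrix (Fin p) (Fin p) ℝ) (S : Finset (Fin p))
    (κ : ℝ) : Prop :=
  ∀ δ : Fin T → Fin p → ℝ, δ ≠ 0 → mixedNormOn Sᶜ δ ≤ 4 * mixedNormOn S δ →
    κ ^ 2 ≤ (∑ t, quadForm Q (δ t)) / ∑ t, ∑ j ∈ S, δ t j ^ 2

/-- The Rayleigh quotients `δ' Q δ / ‖δ‖₂²` of nonzero vectors supported in `S`. -/
def rayleighSet {p : ℕ} (Q : Matrix (Fin p) (Fin p) ℝ) (S : Finset (Fin p)) : Set ℝ :=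
  {r | ∃ δ : Fin p → ℝ, δ ≠ 0 ∧ (∀ j, j ∉ S → δ j = 0) ∧ r = quadForm Q δ / ∑ j, δ j ^ 2}

/-- Minimal sparse eigenvalue `φ{Q, S}` (its square is the minimal Rayleigh quotient);
meaningful for nonempty `S`. -/
def sparseEigMin {p : ℕ} (Q : Matrix (Fin p) (Fin p) ℝ) (S : Finset (Fin p)) : ℝ :=
  Real.sqrt (sInf (rayleighSet Q S))

/-- Maximal sparse eigenvalue over the support set `S` (its square is the maximal quotient). -/
def sparseEigMax {p : ℕ} (Q : Matrix (Fin p) (Fin p) ℝ) (S : Finset (Fin p)) : ℝ :=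
  Real.sqrt (sSup (rayleighSet Q S))

/-- The maximum of `sparseEigMax Q S` over all `S` with at most `m` elements. -/
def sparseEigMaxCard {p : ℕ} (Q : Matrix (Fin p) (Fin p) ℝ) (m : ℕ) : ℝ :=
  sSup {r | ∃ S : Finset (Fin p), S.card ≤ m ∧ r = sparseEigMax Q S}

/-- `R = (A_p / p_min)^(T+1) T A_K (6 λ √s / κ + 8 b √T)` with
`A_p = p_min / (0 ∨ (p_min - b))`. -/
def errorBound (T : ℕ) (pmin AK κ lam b : ℝ) (s : ℕ) : ℝ :=
  (pmin / max 0 (pmin - b) / pmin) ^ (T + 1) * T * AK *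
    (6 * (lam * Real.sqrt s / κ) + 8 * b * Real.sqrt T)

/-- `L = T ((R + b) / (λ √s))²`. -/
def sparsityFactor (T : ℕ) (pmin AK κ lam b : ℝ) (s : ℕ) : ℝ :=
  T * ((errorBound T pmin AK κ lam b s + b) / (lam * Real.sqrt s)) ^ 2

/-- The index set `{m ∈ {1, …, n} : m > 8 s L φ(Q, m)}`, `φ` the maximal `m`-sparse
eigenvalue. -/
def sparsityIndexSet {p : ℕ} (n T : ℕ) (Q : Matrix (Fin p) (Fin p) ℝ) (pmin AK κ lam b : ℝ)
    (s : ℕ) : Set ℕ :=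
  {m | 1 ≤ m ∧ m ≤ n ∧
    8 * s * sparsityFactor T pmin AK κ lam b s * sparseEigMaxCard Q m < (m : ℝ)}

/-- The empirical mean square error `𝔼_n[(p̂_t(x_i*'γ) - p_t(x_i))²]`, where `z i = (x_i, d_i)`
is the sample and `x_i* = R x_i`. -/
def propensityMSE {𝓧 : Type*} [MeasurableSpace 𝓧] {n T p : ℕ} (P : Measure (𝓧 × Fin (T + 1)))
    [IsFiniteMeasure P] (R : 𝓧 → Fin p → ℝ) (z : Fin n → 𝓧 × Fin (T + 1))
    (γ : Fin T → Fin p → ℝ) (t : Fin T) : ℝ :=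
  empMean fun i => (mlogit (logOdds γ (R (z i).1)) t - propensity P t.succ (z i).1) ^ 2

end

end GroupLassoMLogit

/-! Let δ be the difference between an estimate and `γ*`, and q its prediction norm. The loss
expands exactly into a linear term plus the mean Bregman divergence of the log-partition function
(`mlogitLoss_add`). The linear term splits into a score, which is w.p.a.1 at most λ/(8T) in every
coordinate by Hoeffding and a union bound (`wpa1_score_le`), and a bias, which Cauchy–Schwarz bounds
by T b q. The divergence is at least of order q² / (1 + X ‖δ‖₁) once ‖δ‖₁ ≤ N q with N b small
(`sq_fitNorm_le_bregman`). The fitted probabilities at `γ*` need no lower bound of their own: where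
they stray far from the propensities, the loss of curvature is charged to the mean square bias.
Since the denominator grows only linearly in q, comparing both sides gives q = O(λ√s + b) without
any localization (`le_mul_of_quadratic`), provided λs + b√s is small.

It remains to supply ‖δ‖₁ = O(√s q). For the lasso with b = O(λ√s), the restricted eigenvalue gives
this inside the cone, and outside the cone the basic inequality gives it directly
(`mixedNormOn_lasso_le`). By the first-order condition each selected covariate correlates with the
fitted residuals at level λ, so the number selected is at most of order φ² MSE / λ², with φ a
maximal sparse eigenvalue (`card_mul_sq_le`). Only φ at m = n is needed: bounded covariates give φ ≤
X√n, and λs → 0 forces s = o(√n), so m = n lies in the index set on which φ is assumed bounded. A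
support larger than n is excluded by applying the count to a subset of size n.

For the refit, δ is supported on `Ŝ ∪ S*`, of size O(s), where minimal sparse eigenvalues control
‖δ‖₁. As `S*` need not lie in `Ŝ`, the refit is compared with the lasso, whose loss exceeds that of
`γ*` by only O((λ√s + b)²) (`exists_refit_error_le`). The stated rates follow from λ² = O(log(p ∨
n)^(3/2+δ) / n). -/

namespace GroupLassoMLogit

/-! ### The log-partition function -/

section LogPartition

variable {ι : Type*} [Fintype ι]

theorem sum_mul_exp_pos {p : ι → ℝ} (hp : ∀ i, 0 ≤ p i) (hp1 : ∑ i, p i = 1) (h : ι → ℝ) :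
    0 < ∑ i, p i * Real.exp (h i) := by
  have hne : ∃ i ∈ Finset.univ, p i ≠ 0 := by
    by_contra! hc
    rw [Finset.sum_eq_zero hc] at hp1
    exact zero_ne_one hp1
  obtain ⟨i, hi, hpi⟩ := hne
  exact Finset.sum_pos' (fun i _ => mul_nonneg (hp i) (Real.exp_pos _).le)
    ⟨i, hi, mul_pos (lt_of_le_of_ne (hp i) hpi.symm) (Real.exp_pos _)⟩

theorem sum_mul_exp_sub (p : ι → ℝ) (h : ι → ℝ) (m : ℝ) :
    ∑ i, p i * Real.exp (h i - m) = (∑ i, p i * Real.exp (h i)) * Real.exp (-m) := by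
  rw [Finset.sum_mul]
  refine Finset.sum_congr rfl fun i _ => ?_
  rw [sub_eq_add_neg, Real.exp_add, mul_assoc]

/-- Jensen's inequality for the exponential. -/
theorem sum_mul_le_log_sum_exp {p : ι → ℝ} (hp : ∀ i, 0 ≤ p i) (hp1 : ∑ i, p i = 1)
    (h : ι → ℝ) : ∑ i, p i * h i ≤ Real.log (∑ i, p i * Real.exp (h i)) := by
  set m := ∑ i, p i * h i with hm
  rw [Real.le_log_iff_exp_le (sum_mul_exp_pos hp hp1 h)]
  have h1 : 1 ≤ ∑ i, p i * Real.exp (h i - m) := by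
    calc (1 : ℝ) = ∑ i, p i * ((h i - m) + 1) := by
          simp only [mul_add, mul_sub, Finset.sum_add_distrib, Finset.sum_sub_distrib,
            ← Finset.sum_mul, hp1, mul_one, ← hm]
          ring
      _ ≤ _ := Finset.sum_le_sum fun i _ =>
          mul_le_mul_of_nonneg_left (Real.add_one_le_exp _) (hp i)
  rw [sum_mul_exp_sub, Real.exp_neg] at h1
  rwa [← div_eq_mul_inv, one_le_div (Real.exp_pos _)] at h1

/-- The range 2 suffices because h and its mean both lie in [-1, 1]. -/
theorem sq_div_four_le_exp_sub {g : ℝ} (hg : |g| ≤ 2) : g ^ 2 / 4 ≤ Real.exp g - 1 - g := by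
  rcases le_total 0 g with h | h
  · nlinarith [Real.quadratic_le_exp_of_nonneg h]
  · have h2 : -2 ≤ g := (abs_le.mp hg).1
    -- `1 - u + u² / 4 = (1 - u / 2)²` with `u = -g`
    have h3 : 1 + g / 2 ≤ Real.exp (g / 2) := by linarith [Real.add_one_le_exp (g / 2)]
    have h4 : (1 + g / 2) ^ 2 ≤ Real.exp (g / 2) ^ 2 := by
      apply pow_le_pow_left₀ _ h3; linarith
    have h5 : Real.exp (g / 2) ^ 2 = Real.exp g := by
      rw [← Real.exp_nat_mul]; congr 1; push_cast; ring
    nlinarith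

/-- Centering at the mean turns the right side into the log of the mean of exp(h - m), which is at
least log(1 + V/4). Since V ≤ 1, the bound log(1 + y) ≥ y / (1 + y) yields V/5, hence V/8. -/
theorem var_div_eight_le {p : ι → ℝ} (hp : ∀ i, 0 ≤ p i) (hp1 : ∑ i, p i = 1)
    {h : ι → ℝ} (hh : ∀ i, |h i| ≤ 1) :
    (∑ i, p i * h i ^ 2 - (∑ i, p i * h i) ^ 2) / 8
      ≤ Real.log (∑ i, p i * Real.exp (h i)) - ∑ i, p i * h i := by
  set m := ∑ i, p i * h i with hm
  set V := ∑ i, p i * h i ^ 2 - m ^ 2 with hV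
  have hm1 : |m| ≤ 1 := by
    calc |m| ≤ ∑ i, |p i * h i| := Finset.abs_sum_le_sum_abs _ _
      _ ≤ ∑ i, p i := Finset.sum_le_sum fun i _ => by
          rw [abs_mul, abs_of_nonneg (hp i)]
          exact mul_le_of_le_one_right (hp i) (hh i)
      _ = 1 := hp1
  have hVeq : V = ∑ i, p i * (h i - m) ^ 2 := by
    have : ∀ i, p i * (h i - m) ^ 2 = p i * h i ^ 2 - 2 * m * (p i * h i) + m ^ 2 * p i :=
      fun i => by ring
    simp only [this, Finset.sum_add_distrib, Finset.sum_sub_distrib, ← Finset.mul_sum, hp1,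
      ← hm, hV]
    ring
  have hV0 : 0 ≤ V := hVeq ▸ Finset.sum_nonneg fun i _ => mul_nonneg (hp i) (sq_nonneg _)
  have hV1 : V ≤ 1 := by
    have : ∑ i, p i * h i ^ 2 ≤ 1 := by
      rw [← hp1]
      refine Finset.sum_le_sum fun i _ => mul_le_of_le_one_right (hp i) ?_
      rw [← sq_abs]; exact pow_le_one₀ (abs_nonneg _) (hh i)
    nlinarith [sq_nonneg m]
  have h1 : 1 + V / 4 ≤ ∑ i, p i * Real.exp (h i - m) := by
    calc 1 + V / 4 = ∑ i, p i * (1 + (h i - m) + (h i - m) ^ 2 / 4) := by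
          have : ∀ i, p i * (1 + (h i - m) + (h i - m) ^ 2 / 4)
              = p i + (p i * h i - m * p i) + (p i * (h i - m) ^ 2) / 4 := fun i => by ring
          simp only [this, Finset.sum_add_distrib, Finset.sum_sub_distrib, ← Finset.mul_sum, hp1,
            ← hm, ← Finset.sum_div, ← hVeq]
          ring
      _ ≤ _ := Finset.sum_le_sum fun i _ => by
          refine mul_le_mul_of_nonneg_left ?_ (hp i)
          have : |h i - m| ≤ 2 := (abs_sub _ _).trans (by linarith [hh i])
          linarith [sq_div_four_le_exp_sub this]
  have hpos := sum_mul_exp_pos hp hp1 h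
  have h2 : Real.log (∑ i, p i * Real.exp (h i - m))
      = Real.log (∑ i, p i * Real.exp (h i)) - m := by
    rw [sum_mul_exp_sub, Real.log_mul hpos.ne' (Real.exp_pos _).ne', Real.log_exp]; ring
  rw [← h2]
  have h3 : Real.log (1 + V / 4) ≤ Real.log (∑ i, p i * Real.exp (h i - m)) :=
    Real.log_le_log (by positivity) h1
  refine le_trans ?_ h3
  have h4 := Real.one_sub_inv_le_log_of_pos (show 0 < 1 + V / 4 by positivity)
  refine le_trans ?_ h4
  have h5 : 1 - (1 + V / 4)⁻¹ = (V / 4) / (1 + V / 4) := by field_simp; ring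
  rw [h5, div_le_div_iff₀ (by norm_num) (by positivity)]
  nlinarith

/-- A quadratic-over-linear lower bound for the Bregman divergence of the log-partition
function. -/
theorem var_div_le {p : ι → ℝ} (hp : ∀ i, 0 ≤ p i) (hp1 : ∑ i, p i = 1)
    {h : ι → ℝ} {B : ℝ} (hB : 0 ≤ B) (hh : ∀ i, |h i| ≤ B) :
    (∑ i, p i * h i ^ 2 - (∑ i, p i * h i) ^ 2) / (8 * (1 + B))
      ≤ Real.log (∑ i, p i * Real.exp (h i)) - ∑ i, p i * h i := by
  have hB1 : 0 < 1 + B := by linarith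
  -- Dividing by 1 + B brings h into [-1, 1] and costs (1 + B)² in the variance.
  have h1 := var_div_eight_le hp hp1 (h := fun i => h i / (1 + B)) fun i => by
    rw [abs_div, abs_of_pos hB1, div_le_one hB1]; linarith [hh i]
  have hpos := sum_mul_exp_pos hp hp1 (fun i => h i / (1 + B))
  -- The power-mean inequality with exponent 1 + B recovers one of the two factors, so the final
  -- loss is linear in B.
  have h2 : Real.log (∑ i, p i * Real.exp (h i / (1 + B)))
      ≤ Real.log (∑ i, p i * Real.exp (h i)) / (1 + B) := by
    have := Real.arith_mean_le_rpow_mean Finset.univ p (fun i => Real.exp (h i / (1 + B)))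
      (fun i _ => hp i) hp1 (fun i _ => (Real.exp_pos _).le) (p := 1 + B) (by linarith)
    have h3 := Real.log_le_log hpos this
    have h4 : ∀ i, Real.exp (h i / (1 + B)) ^ (1 + B) = Real.exp (h i) := fun i => by
      rw [← Real.exp_mul, div_mul_cancel₀ _ hB1.ne']
    simp only [h4] at h3
    rw [Real.log_rpow (sum_mul_exp_pos hp hp1 h)] at h3
    calc _ ≤ _ := h3
      _ = _ := by ring
  have h5 : ∑ i, p i * (h i / (1 + B)) = (∑ i, p i * h i) / (1 + B) := by
    rw [Finset.sum_div]; exact Finset.sum_congr rfl fun i _ => by ring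
  have h6 : ∑ i, p i * (h i / (1 + B)) ^ 2 = (∑ i, p i * h i ^ 2) / (1 + B) ^ 2 := by
    rw [Finset.sum_div]; exact Finset.sum_congr rfl fun i _ => by rw [div_pow]; ring
  rw [h5, h6] at h1
  have h7 := h1.trans (sub_le_sub_right h2 _)
  have h8 := mul_le_mul_of_nonneg_right h7 hB1.le
  calc _ = ((∑ i, p i * h i ^ 2) / (1 + B) ^ 2 - ((∑ i, p i * h i) / (1 + B)) ^ 2) / 8
          * (1 + B) := by field_simp
    _ ≤ _ := h8
    _ = _ := by field_simp

end LogPartition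

/-! ### Choice probabilities: curvature and Lipschitz bounds. -/

section MLogit

variable {T : ℕ}

theorem one_add_sum_exp_pos (w : Fin T → ℝ) : 0 < 1 + ∑ u, Real.exp (w u) := by positivity

theorem mlogit_pos (w : Fin T → ℝ) (t : Fin T) : 0 < mlogit w t :=
  div_pos (Real.exp_pos _) (one_add_sum_exp_pos w)

theorem mlogit_le_one (w : Fin T → ℝ) (t : Fin T) : mlogit w t ≤ 1 := by
  rw [mlogit, div_le_one (one_add_sum_exp_pos w)]
  have := Finset.single_le_sum (f := fun u => Real.exp (w u))
    (fun u _ => (Real.exp_pos _).le) (Finset.mem_univ t)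
  linarith

theorem baseline_eq (w : Fin T → ℝ) :
    1 - ∑ t, mlogit w t = (1 + ∑ u, Real.exp (w u))⁻¹ := by
  have := one_add_sum_exp_pos w
  simp only [mlogit, ← Finset.sum_div]
  field_simp
  ring

theorem baseline_pos (w : Fin T → ℝ) : 0 < 1 - ∑ t, mlogit w t := by
  rw [baseline_eq]; exact inv_pos.mpr (one_add_sum_exp_pos w)

/-- The Bregman divergence of the log-partition function. -/
noncomputable def logitBregman (w h : Fin T → ℝ) : ℝ :=
  Real.log (1 + ∑ t, Real.exp (w t + h t)) - Real.log (1 + ∑ t, Real.exp (w t))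
    - ∑ t, mlogit w t * h t

/-- All choice probabilities, the baseline being `none`. -/
noncomputable def fullProb (w : Fin T → ℝ) : Option (Fin T) → ℝ
  | none => 1 - ∑ t, mlogit w t
  | some t => mlogit w t

theorem fullProb_nonneg (w : Fin T → ℝ) (o : Option (Fin T)) : 0 ≤ fullProb w o := by
  cases o with
  | none => exact (baseline_pos w).le
  | some t => exact (mlogit_pos w t).le

theorem sum_fullProb (w : Fin T → ℝ) : ∑ o, fullProb w o = 1 := by
  rw [Fintype.sum_option]; simp [fullProb]

theorem logitBregman_eq (w h : Fin T → ℝ) :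
    logitBregman w h = Real.log (∑ o, fullProb w o * Real.exp (o.elim 0 h))
      - ∑ o, fullProb w o * o.elim 0 h := by
  have hw := one_add_sum_exp_pos w
  have hwh : 0 < 1 + ∑ t, Real.exp (w t + h t) := by positivity
  rw [logitBregman, Fintype.sum_option, Fintype.sum_option]
  simp only [fullProb, Option.elim, mul_zero, zero_add, Real.exp_zero, mul_one]
  rw [← Real.log_div hwh.ne' hw.ne', baseline_eq]
  congr 2
  rw [add_div, Finset.sum_div, inv_eq_one_div]
  congr 1
  exact Finset.sum_congr rfl fun t _ => by rw [mlogit, Real.exp_add]; ring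

theorem logitBregman_nonneg (w h : Fin T → ℝ) : 0 ≤ logitBregman w h := by
  rw [logitBregman_eq, sub_nonneg]
  exact sum_mul_le_log_sum_exp (fullProb_nonneg w) (sum_fullProb w) _

/-- With h extended by 0 at the baseline, Cauchy–Schwarz gives (∑ p h)² ≤ (1 - p₀) ∑ p h². Hence the
variance is at least p₀ ∑ p h² ≥ a² ∑ h². -/
theorem le_logitBregman {w h : Fin T → ℝ} {a B : ℝ} (ha : 0 ≤ a) (hB : 0 ≤ B)
    (hh : ∀ t, |h t| ≤ B) (hw : ∀ t, a ≤ mlogit w t) (hw0 : a ≤ 1 - ∑ t, mlogit w t) :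
    a ^ 2 * (∑ t, h t ^ 2) / (8 * (1 + B)) ≤ logitBregman w h := by
  have key := var_div_le (fullProb_nonneg w) (sum_fullProb w) (h := fun o => o.elim 0 h) hB
    (fun o => by cases o with
      | none => simpa using hB
      | some t => exact hh t)
  rw [← logitBregman_eq] at key
  refine le_trans (div_le_div_of_nonneg_right ?_ (by positivity)) key
  simp only [Fintype.sum_option, fullProb, Option.elim, mul_zero, zero_add, ne_eq,
    OfNat.ofNat_ne_zero, not_false_eq_true, zero_pow]
  set W := ∑ t, mlogit w t * h t ^ 2 with hW
  have h1 : (∑ t, mlogit w t * h t) ^ 2 ≤ (∑ t, mlogit w t) * W := by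
    refine Finset.sum_sq_le_sum_mul_sum_of_sq_le_mul _ (fun t _ => (mlogit_pos w t).le)
      (fun t _ => mul_nonneg (mlogit_pos w t).le (sq_nonneg _)) fun t _ => le_of_eq (by ring)
  have h2 : a * ∑ t, h t ^ 2 ≤ W := by
    rw [Finset.mul_sum]
    exact Finset.sum_le_sum fun t _ => mul_le_mul_of_nonneg_right (hw t) (sq_nonneg _)
  have h3 : 0 ≤ ∑ t, h t ^ 2 := Finset.sum_nonneg fun t _ => sq_nonneg _
  nlinarith [mul_le_mul hw0 h2 (by positivity) (ha.trans hw0)]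

/-- Numerator and denominator each change by a factor at most exp B, so the probability keeps a
share exp(-2B), and 1 - exp(-2B) ≤ 2B. -/
theorem mlogit_sub_le (w h : Fin T → ℝ) {B : ℝ} (hh : ∀ t, |h t| ≤ B) (t : Fin T) :
    mlogit w t - mlogit (fun u => w u + h u) t ≤ 2 * B := by
  have hB : 0 ≤ B := (abs_nonneg _).trans (hh t)
  have hp := mlogit_pos w t
  have hp1 := mlogit_le_one w t
  have h1 : Real.exp (-(2 * B)) * mlogit w t ≤ mlogit (fun u => w u + h u) t := by
    have hden : 1 + ∑ u, Real.exp (w u + h u) ≤ Real.exp B * (1 + ∑ u, Real.exp (w u)) := by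
      rw [mul_add, mul_one, Finset.mul_sum]
      refine add_le_add (Real.one_le_exp hB) (Finset.sum_le_sum fun u _ => ?_)
      rw [add_comm, Real.exp_add]
      exact mul_le_mul_of_nonneg_right (Real.exp_le_exp.mpr (abs_le.mp (hh u)).2)
        (Real.exp_pos _).le
    have hnum : Real.exp (-B) * Real.exp (w t) ≤ Real.exp (w t + h t) := by
      rw [← Real.exp_add]
      exact Real.exp_le_exp.mpr (by linarith [(abs_le.mp (hh t)).1])
    rw [mlogit, mlogit]
    calc _ = (Real.exp (-B) * Real.exp (w t)) / (Real.exp B * (1 + ∑ u, Real.exp (w u))) := by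
          rw [show -(2 * B) = -B - B by ring, Real.exp_sub]
          field_simp
      _ ≤ _ := div_le_div₀ (Real.exp_pos _).le hnum (by positivity) hden
  have h2 := Real.add_one_le_exp (-(2 * B))
  nlinarith

theorem abs_mlogit_sub_le (w h : Fin T → ℝ) {B : ℝ} (hh : ∀ t, |h t| ≤ B) (t : Fin T) :
    |mlogit (fun u => w u + h u) t - mlogit w t| ≤ 2 * B := by
  have h1 := mlogit_sub_le w h hh t
  -- The opposite sign comes from shifting back from w + h by -h.
  have h2 := mlogit_sub_le (fun u => w u + h u) (fun u => -h u) (B := B)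
    (fun u => by rw [abs_neg]; exact hh u) t
  simp only [add_neg_cancel_right] at h2
  rw [abs_le]; constructor <;> linarith

end MLogit

/-! ### Empirical means -/

section EmpMean

variable {n : ℕ}

theorem empMean_add (f g : Fin n → ℝ) :
    empMean (fun i => f i + g i) = empMean f + empMean g := by
  simp [empMean, Finset.sum_add_distrib, add_div]

theorem empMean_sub (f g : Fin n → ℝ) :
    empMean (fun i => f i - g i) = empMean f - empMean g := by
  simp [empMean, Finset.sum_sub_distrib, sub_div]

theorem empMean_const_mul (c : ℝ) (f : Fin n → ℝ) :
    empMean (fun i => c * f i) = c * empMean f := by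
  simp [empMean, ← Finset.mul_sum, mul_div_assoc]

theorem empMean_mul_const (c : ℝ) (f : Fin n → ℝ) :
    empMean (fun i => f i * c) = empMean f * c := by
  simp [empMean, ← Finset.sum_mul, div_mul_eq_mul_div]

theorem empMean_sum {ι : Type*} (s : Finset ι) (f : ι → Fin n → ℝ) :
    empMean (fun i => ∑ k ∈ s, f k i) = ∑ k ∈ s, empMean (f k) := by
  simp only [empMean]; rw [Finset.sum_comm, Finset.sum_div]

theorem empMean_mono {f g : Fin n → ℝ} (h : ∀ i, f i ≤ g i) : empMean f ≤ empMean g :=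
  div_le_div_of_nonneg_right (Finset.sum_le_sum fun i _ => h i) n.cast_nonneg

theorem empMean_nonneg {f : Fin n → ℝ} (h : ∀ i, 0 ≤ f i) : 0 ≤ empMean f :=
  div_nonneg (Finset.sum_nonneg fun i _ => h i) n.cast_nonneg

theorem empMean_le_of_le {f : Fin n → ℝ} {c : ℝ} (hc : 0 ≤ c) (h : ∀ i, f i ≤ c) :
    empMean f ≤ c := by
  refine div_le_of_le_mul₀ n.cast_nonneg hc ?_
  calc ∑ i, f i ≤ ∑ _i : Fin n, c := Finset.sum_le_sum fun i _ => h i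
    _ = c * n := by simp [mul_comm]

theorem abs_empMean_le (f : Fin n → ℝ) : |empMean f| ≤ empMean fun i => |f i| := by
  rw [empMean, abs_div, Nat.abs_cast]
  exact div_le_div_of_nonneg_right (Finset.abs_sum_le_sum_abs _ _) n.cast_nonneg

theorem sq_empMean_mul_le (f g : Fin n → ℝ) :
    empMean (fun i => f i * g i) ^ 2
      ≤ empMean (fun i => f i ^ 2) * empMean (fun i => g i ^ 2) := by
  simp only [empMean, div_pow, div_mul_div_comm, ← sq]
  exact div_le_div_of_nonneg_right (Finset.sum_mul_sq_le_sq_mul_sq _ _ _) (by positivity)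

theorem abs_empMean_mul_le (f g : Fin n → ℝ) :
    |empMean (fun i => f i * g i)|
      ≤ Real.sqrt (empMean fun i => f i ^ 2) * Real.sqrt (empMean fun i => g i ^ 2) := by
  rw [← Real.sqrt_mul (empMean_nonneg fun i => sq_nonneg _)]
  exact Real.abs_le_sqrt (sq_empMean_mul_le f g)

end EmpMean

/-! ### Norms of coefficient collections -/

section Norms

variable {n T p : ℕ}

/-- The Euclidean norm over treatments of the coefficients of covariate `j`. -/
noncomputable def colNorm (δ : Fin T → Fin p → ℝ) (j : Fin p) : ℝ :=
  Real.sqrt (∑ t, δ t j ^ 2)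

theorem colNorm_eq_norm (δ : Fin T → Fin p → ℝ) (j : Fin p) :
    colNorm δ j = ‖(WithLp.toLp 2 fun t => δ t j : EuclideanSpace ℝ (Fin T))‖ := by
  simp [EuclideanSpace.norm_eq, colNorm]

theorem colNorm_nonneg (δ : Fin T → Fin p → ℝ) (j : Fin p) : 0 ≤ colNorm δ j :=
  Real.sqrt_nonneg _

theorem sq_colNorm (δ : Fin T → Fin p → ℝ) (j : Fin p) : colNorm δ j ^ 2 = ∑ t, δ t j ^ 2 :=
  Real.sq_sqrt (Finset.sum_nonneg fun _ _ => sq_nonneg _)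

theorem colNorm_add_le (γ δ : Fin T → Fin p → ℝ) (j : Fin p) :
    colNorm (γ + δ) j ≤ colNorm γ j + colNorm δ j := by
  simp only [colNorm_eq_norm]
  exact norm_add_le (WithLp.toLp 2 fun t => γ t j : EuclideanSpace ℝ (Fin T))
    (WithLp.toLp 2 fun t => δ t j)

theorem colNorm_neg (γ : Fin T → Fin p → ℝ) (j : Fin p) : colNorm (-γ) j = colNorm γ j := by
  simp [colNorm]

theorem abs_le_colNorm (δ : Fin T → Fin p → ℝ) (t : Fin T) (j : Fin p) :
    |δ t j| ≤ colNorm δ j :=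
  Real.abs_le_sqrt (Finset.single_le_sum (f := fun t => δ t j ^ 2)
    (fun _ _ => sq_nonneg _) (Finset.mem_univ t))

theorem colNorm_le_sum_abs (δ : Fin T → Fin p → ℝ) (j : Fin p) :
    colNorm δ j ≤ ∑ t, |δ t j| := by
  refine Real.sqrt_le_iff.mpr ⟨Finset.sum_nonneg fun _ _ => abs_nonneg _, ?_⟩
  calc ∑ t, δ t j ^ 2 = ∑ t, |δ t j| ^ 2 := by simp
    _ ≤ _ := Finset.sum_sq_le_sq_sum_of_nonneg fun _ _ => abs_nonneg _

theorem mixedNormOn_eq (S : Finset (Fin p)) (δ : Fin T → Fin p → ℝ) :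
    mixedNormOn S δ = ∑ j ∈ S, colNorm δ j := rfl

theorem mem_suppUnion {γ : Fin T → Fin p → ℝ} {j : Fin p} :
    j ∈ suppUnion γ ↔ 0 < colNorm γ j := by simp [suppUnion, colNorm]

theorem eq_zero_of_notMem_suppUnion {γ : Fin T → Fin p → ℝ} {j : Fin p}
    (h : j ∉ suppUnion γ) (t : Fin T) : γ t j = 0 := by
  rw [mem_suppUnion, not_lt] at h
  exact abs_nonpos_iff.mp ((abs_le_colNorm γ t j).trans h)

theorem mixedNormOn_nonneg (S : Finset (Fin p)) (δ : Fin T → Fin p → ℝ) :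
    0 ≤ mixedNormOn S δ := Finset.sum_nonneg fun _ _ => colNorm_nonneg _ _

theorem mixedNormOn_add_compl (S : Finset (Fin p)) (δ : Fin T → Fin p → ℝ) :
    mixedNormOn S δ + mixedNormOn Sᶜ δ = mixedNormOn Finset.univ δ := by
  simp only [mixedNormOn_eq]; exact Finset.sum_add_sum_compl S _

/-- The sum of all absolute coefficients. -/
noncomputable def absSum (δ : Fin T → Fin p → ℝ) : ℝ := ∑ t, ∑ j, |δ t j|

theorem absSum_nonneg (δ : Fin T → Fin p → ℝ) : 0 ≤ absSum δ :=
  Finset.sum_nonneg fun _ _ => Finset.sum_nonneg fun _ _ => abs_nonneg _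

theorem mixedNormOn_univ_le_absSum (δ : Fin T → Fin p → ℝ) :
    mixedNormOn Finset.univ δ ≤ absSum δ := by
  rw [absSum, Finset.sum_comm]
  exact Finset.sum_le_sum fun j _ => colNorm_le_sum_abs δ j

theorem absSum_le_mul_mixedNormOn (δ : Fin T → Fin p → ℝ) :
    absSum δ ≤ T * mixedNormOn Finset.univ δ := by
  rw [absSum]
  calc ∑ t, ∑ j, |δ t j| ≤ ∑ _t : Fin T, mixedNormOn Finset.univ δ :=
        Finset.sum_le_sum fun t _ => Finset.sum_le_sum fun j _ => abs_le_colNorm δ t j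
    _ = _ := by simp

theorem row_le_absSum (δ : Fin T → Fin p → ℝ) (t : Fin T) : ∑ j, |δ t j| ≤ absSum δ :=
  Finset.single_le_sum (f := fun t => ∑ j, |δ t j|)
    (fun _ _ => Finset.sum_nonneg fun _ _ => abs_nonneg _) (Finset.mem_univ t)

theorem logOdds_add (γ δ : Fin T → Fin p → ℝ) (xi : Fin p → ℝ) :
    logOdds (γ + δ) xi = fun t => logOdds γ xi t + logOdds δ xi t := by
  funext t; simp [logOdds, mul_add, Finset.sum_add_distrib]

theorem abs_logOdds_le {xi : Fin p → ℝ} {X : ℝ} (hX : ∀ j, |xi j| ≤ X)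
    (δ : Fin T → Fin p → ℝ) (t : Fin T) : |logOdds δ xi t| ≤ X * ∑ j, |δ t j| := by
  rw [Finset.mul_sum]
  refine (Finset.abs_sum_le_sum_abs _ _).trans (Finset.sum_le_sum fun j _ => ?_)
  rw [abs_mul]; exact mul_le_mul_of_nonneg_right (hX j) (abs_nonneg _)

theorem sum_sq_logOdds_le {xi : Fin p → ℝ} {X : ℝ} (hX0 : 0 ≤ X) (hX : ∀ j, |xi j| ≤ X)
    (δ : Fin T → Fin p → ℝ) : ∑ t, logOdds δ xi t ^ 2 ≤ X ^ 2 * absSum δ ^ 2 := by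
  calc ∑ t, logOdds δ xi t ^ 2 ≤ ∑ t, (X * ∑ j, |δ t j|) ^ 2 :=
        Finset.sum_le_sum fun t _ => by
          rw [← sq_abs]; exact pow_le_pow_left₀ (abs_nonneg _) (abs_logOdds_le hX δ t) 2
    _ ≤ (∑ t, X * ∑ j, |δ t j|) ^ 2 := Finset.sum_sq_le_sq_sum_of_nonneg fun t _ =>
        mul_nonneg hX0 (Finset.sum_nonneg fun _ _ => abs_nonneg _)
    _ = _ := by rw [← Finset.mul_sum, mul_pow]; rfl

/-- The prediction norm `(∑_t δ_t' Q δ_t)^{1/2}`. -/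
noncomputable def fitNorm (x : Fin n → Fin p → ℝ) (δ : Fin T → Fin p → ℝ) : ℝ :=
  Real.sqrt (empMean fun i => ∑ t, logOdds δ (x i) t ^ 2)

theorem fitNorm_nonneg (x : Fin n → Fin p → ℝ) (δ : Fin T → Fin p → ℝ) : 0 ≤ fitNorm x δ :=
  Real.sqrt_nonneg _

theorem sq_fitNorm (x : Fin n → Fin p → ℝ) (δ : Fin T → Fin p → ℝ) :
    fitNorm x δ ^ 2 = empMean fun i => ∑ t, logOdds δ (x i) t ^ 2 :=
  Real.sq_sqrt (empMean_nonneg fun _ => Finset.sum_nonneg fun _ _ => sq_nonneg _)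

theorem empMean_sq_logOdds_le (x : Fin n → Fin p → ℝ) (δ : Fin T → Fin p → ℝ) (t : Fin T) :
    empMean (fun i => logOdds δ (x i) t ^ 2) ≤ fitNorm x δ ^ 2 := by
  rw [sq_fitNorm]
  exact empMean_mono fun i => Finset.single_le_sum (f := fun t => logOdds δ (x i) t ^ 2)
    (fun _ _ => sq_nonneg _) (Finset.mem_univ t)

theorem quadForm_gram (x : Fin n → Fin p → ℝ) (v : Fin p → ℝ) :
    quadForm (gram x) v = empMean fun i => (∑ j, x i j * v j) ^ 2 := by
  have : ∀ i, (∑ j, x i j * v j) ^ 2 = ∑ j, ∑ k, v j * (x i j * x i k) * v k := fun i => by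
    rw [sq, Finset.sum_mul_sum]
    exact Finset.sum_congr rfl fun j _ => Finset.sum_congr rfl fun k _ => by ring
  simp only [this, empMean_sum, empMean_const_mul, empMean_mul_const, quadForm, gram]

theorem sum_quadForm_gram (x : Fin n → Fin p → ℝ) (δ : Fin T → Fin p → ℝ) :
    ∑ t, quadForm (gram x) (δ t) = fitNorm x δ ^ 2 := by
  rw [sq_fitNorm, empMean_sum]
  exact Finset.sum_congr rfl fun t _ => quadForm_gram x (δ t)

theorem quadForm_gram_nonneg (x : Fin n → Fin p → ℝ) (v : Fin p → ℝ) :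
    0 ≤ quadForm (gram x) v := by
  rw [quadForm_gram]; exact empMean_nonneg fun _ => sq_nonneg _

end Norms

/-! ### The loss and its gradient -/

section Loss

variable {n T p : ℕ}

/-- The gradient of the multinomial logistic loss. -/
noncomputable def lossGrad (x : Fin n → Fin p → ℝ) (d : Fin n → Fin (T + 1))
    (γ : Fin T → Fin p → ℝ) (t : Fin T) (j : Fin p) : ℝ :=
  empMean fun i => x i j * (mlogit (logOdds γ (x i)) t - if d i = t.succ then 1 else 0)

/-- The score `𝔼_n[x_{ij} (1{d_i = t} - π_{it})]`. -/
noncomputable def score (x : Fin n → Fin p → ℝ) (d : Fin n → Fin (T + 1))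
    (π : Fin n → Fin T → ℝ) (t : Fin T) (j : Fin p) : ℝ :=
  empMean fun i => x i j * ((if d i = t.succ then 1 else 0) - π i t)

theorem lossGrad_eq (x : Fin n → Fin p → ℝ) (d : Fin n → Fin (T + 1))
    (π : Fin n → Fin T → ℝ) (γ : Fin T → Fin p → ℝ) (t : Fin T) (j : Fin p) :
    lossGrad x d γ t j
      = empMean (fun i => x i j * (mlogit (logOdds γ (x i)) t - π i t)) - score x d π t j := by
  rw [lossGrad, score, ← empMean_sub]; congr 1; funext i; ring

theorem sum_lossGrad_mul (x : Fin n → Fin p → ℝ) (d : Fin n → Fin (T + 1))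
    (γ δ : Fin T → Fin p → ℝ) :
    ∑ t, ∑ j, lossGrad x d γ t j * δ t j = empMean fun i => ∑ t,
      (mlogit (logOdds γ (x i)) t - if d i = t.succ then 1 else 0) * logOdds δ (x i) t := by
  simp only [lossGrad, logOdds, Finset.mul_sum, empMean_sum, ← empMean_mul_const]
  refine Finset.sum_congr rfl fun t _ => Finset.sum_congr rfl fun j _ => ?_
  congr 1; funext i; ring

/-- The treatment indicators enter the loss linearly, so the remainder after the gradient comes from
the log-partition function alone. -/
theorem mlogitLoss_add (x : Fin n → Fin p → ℝ) (d : Fin n → Fin (T + 1))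
    (γ δ : Fin T → Fin p → ℝ) :
    mlogitLoss x d (γ + δ) = mlogitLoss x d γ + ∑ t, ∑ j, lossGrad x d γ t j * δ t j
      + empMean fun i => logitBregman (logOdds γ (x i)) (logOdds δ (x i)) := by
  rw [sum_lossGrad_mul, mlogitLoss, mlogitLoss, ← empMean_add, ← empMean_add]
  congr 1; funext i
  simp only [logOdds_add, logitBregman, sub_mul, Finset.sum_sub_distrib, ite_mul, one_mul,
    zero_mul]
  have : (∑ t : Fin T, if d i = t.succ then logOdds γ (x i) t + logOdds δ (x i) t else 0)
      = (∑ t : Fin T, if d i = t.succ then logOdds γ (x i) t else 0)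
        + ∑ t : Fin T, if d i = t.succ then logOdds δ (x i) t else 0 := by
    rw [← Finset.sum_add_distrib]
    exact Finset.sum_congr rfl fun t _ => by split_ifs <;> simp
  rw [this]; ring

theorem mlogitLoss_add_ge (x : Fin n → Fin p → ℝ) (d : Fin n → Fin (T + 1))
    (γ δ : Fin T → Fin p → ℝ) :
    mlogitLoss x d γ + ∑ t, ∑ j, lossGrad x d γ t j * δ t j ≤ mlogitLoss x d (γ + δ) := by
  rw [mlogitLoss_add]
  linarith [empMean_nonneg fun i => logitBregman_nonneg (logOdds γ (x i)) (logOdds δ (x i))]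

/-- The mean square distance of the fitted probabilities from `π`. -/
noncomputable def fitMSE (x : Fin n → Fin p → ℝ) (π : Fin n → Fin T → ℝ)
    (γ : Fin T → Fin p → ℝ) (t : Fin T) : ℝ :=
  empMean fun i => (mlogit (logOdds γ (x i)) t - π i t) ^ 2

variable {x : Fin n → Fin p → ℝ} {d : Fin n → Fin (T + 1)} {π : Fin n → Fin T → ℝ}
  {γ δ : Fin T → Fin p → ℝ}

theorem abs_sum_score_mul_le {σ : ℝ} (hσ : ∀ t j, |score x d π t j| ≤ σ)
    (δ : Fin T → Fin p → ℝ) : |∑ t, ∑ j, score x d π t j * δ t j| ≤ σ * absSum δ := by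
  rw [absSum, Finset.mul_sum]
  refine (Finset.abs_sum_le_sum_abs _ _).trans (Finset.sum_le_sum fun t _ => ?_)
  rw [Finset.mul_sum]
  refine (Finset.abs_sum_le_sum_abs _ _).trans (Finset.sum_le_sum fun j _ => ?_)
  rw [abs_mul]; exact mul_le_mul_of_nonneg_right (hσ t j) (abs_nonneg _)

/-- The gradient at γ is bias minus score. Hölder pairs the score with the ℓ₁ norm; Cauchy–Schwarz
pairs the bias with the prediction norm, so that b is not multiplied by √s. -/
theorem neg_sum_lossGrad_mul_le {σ b : ℝ} (hσ : ∀ t j, |score x d π t j| ≤ σ) (hb : 0 ≤ b)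
    (hbias : ∀ t, fitMSE x π γ t ≤ b ^ 2) (δ : Fin T → Fin p → ℝ) :
    -(∑ t, ∑ j, lossGrad x d γ t j * δ t j) ≤ σ * absSum δ + T * b * fitNorm x δ := by
  have h1 : ∑ t, ∑ j, lossGrad x d γ t j * δ t j
      = ∑ t, empMean (fun i => (mlogit (logOdds γ (x i)) t - π i t) * logOdds δ (x i) t)
        - ∑ t, ∑ j, score x d π t j * δ t j := by
    have h0 : ∀ t j, lossGrad x d γ t j * δ t j
        = empMean (fun i => x i j * (mlogit (logOdds γ (x i)) t - π i t)) * δ t j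
          - score x d π t j * δ t j := fun t j => by rw [lossGrad_eq x d π, sub_mul]
    simp only [h0, Finset.sum_sub_distrib]
    congr 1
    refine Finset.sum_congr rfl fun t _ => ?_
    simp only [logOdds, Finset.mul_sum, empMean_sum, ← empMean_mul_const]
    refine Finset.sum_congr rfl fun j _ => ?_
    congr 1; funext i; ring
  have h2 : ∀ t, |empMean (fun i => (mlogit (logOdds γ (x i)) t - π i t) * logOdds δ (x i) t)|
      ≤ b * fitNorm x δ := fun t => by
    refine (abs_empMean_mul_le _ _).trans ?_
    refine mul_le_mul (Real.sqrt_le_iff.mpr ⟨hb, hbias t⟩)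
      (Real.sqrt_le_iff.mpr ⟨fitNorm_nonneg x δ, empMean_sq_logOdds_le x δ t⟩)
      (Real.sqrt_nonneg _) hb
  have h3 : -∑ t, empMean (fun i => (mlogit (logOdds γ (x i)) t - π i t) * logOdds δ (x i) t)
      ≤ T * b * fitNorm x δ := by
    rw [← Finset.sum_neg_distrib]
    calc _ ≤ ∑ _t : Fin T, b * fitNorm x δ :=
          Finset.sum_le_sum fun t _ => (neg_le_abs _).trans (h2 t)
      _ = _ := by simp; ring
  have h4 := (le_abs_self _).trans (abs_sum_score_mul_le hσ δ)
  rw [h1]; linarith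

/-- Upper bound for the Bregman divergence of the loss at an approximate minimizer. -/
theorem empMean_logitBregman_le {σ b U : ℝ} (hσ : ∀ t j, |score x d π t j| ≤ σ) (hb : 0 ≤ b)
    (hbias : ∀ t, fitMSE x π γ t ≤ b ^ 2)
    (hU : mlogitLoss x d (γ + δ) ≤ mlogitLoss x d γ + U) :
    empMean (fun i => logitBregman (logOdds γ (x i)) (logOdds δ (x i)))
      ≤ U + σ * absSum δ + T * b * fitNorm x δ := by
  have := neg_sum_lossGrad_mul_le (d := d) hσ hb hbias δ
  rw [mlogitLoss_add] at hU
  linarith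

/-- Restricted strong convexity of the loss at `γ`, in directions where the `ℓ₁` norm is
controlled by the prediction norm. -/
theorem sq_fitNorm_le_bregman {X pmin b N : ℝ} (hX0 : 0 ≤ X) (hX : ∀ i j, |x i j| ≤ X)
    (hpmin : 0 < pmin) (hπ : ∀ i t, pmin ≤ π i t) (hπ0 : ∀ i, pmin ≤ 1 - ∑ t, π i t)
    (hbias : ∀ t, fitMSE x π γ t ≤ b ^ 2)
    (hN : absSum δ ≤ N * fitNorm x δ) (hsmall : 8 * (T * X * N * b) ^ 2 ≤ pmin ^ 2) :
    pmin ^ 2 / 64 * fitNorm x δ ^ 2 ≤ (1 + X * (N * fitNorm x δ))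
      * empMean fun i => logitBregman (logOdds γ (x i)) (logOdds δ (x i)) := by
  set q := fitNorm x δ with hq
  set l := absSum δ with hl
  have hl0 : 0 ≤ l := absSum_nonneg δ
  set B := X * l with hB
  have hB0 : 0 ≤ B := mul_nonneg hX0 hl0
  -- The subtracted term is a Markov-type penalty: it makes the left side nonpositive at
  -- observations whose fitted probabilities may be too small for curvature, and its mean is
  -- controlled by the bias.
  have hpt : ∀ i, (pmin / 2) ^ 2 / (8 * (1 + B)) * (∑ t, logOdds δ (x i) t ^ 2
      - X ^ 2 * l ^ 2 * (4 * T / pmin ^ 2 * ∑ t, (mlogit (logOdds γ (x i)) t - π i t) ^ 2))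
      ≤ logitBregman (logOdds γ (x i)) (logOdds δ (x i)) := fun i => by
    set r : Fin T → ℝ := fun t => mlogit (logOdds γ (x i)) t - π i t with hr
    have hh : ∀ t, |logOdds δ (x i) t| ≤ B := fun t =>
      (abs_logOdds_le (hX i) δ t).trans (mul_le_mul_of_nonneg_left (row_le_absSum δ t) hX0)
    have hc : 0 ≤ (pmin / 2) ^ 2 / (8 * (1 + B)) := by positivity
    rcases le_or_gt (∑ t, |r t|) (pmin / 2) with hgood | hbad
    · have h1 : ∀ t, pmin / 2 ≤ mlogit (logOdds γ (x i)) t := fun t => by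
        have h2 : |r t| ≤ pmin / 2 := (Finset.single_le_sum (f := fun t => |r t|)
          (fun _ _ => abs_nonneg _) (Finset.mem_univ t)).trans hgood
        have h3 := neg_le_of_abs_le h2
        simp only [hr] at h3
        linarith [hπ i t]
      have h0 : pmin / 2 ≤ 1 - ∑ t, mlogit (logOdds γ (x i)) t := by
        have h2 : ∑ t, r t ≤ pmin / 2 :=
          (Finset.sum_le_sum fun t _ => le_abs_self (r t)).trans hgood
        simp only [hr, Finset.sum_sub_distrib] at h2
        linarith [hπ0 i]
      have := le_logitBregman (by positivity) hB0 hh h1 h0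
      refine le_trans ?_ this
      rw [mul_div_right_comm ((pmin / 2) ^ 2)]
      refine mul_le_mul_of_nonneg_left (sub_le_self _ ?_) hc
      positivity
    · refine le_trans ?_ (logitBregman_nonneg _ _)
      refine mul_nonpos_of_nonneg_of_nonpos hc (sub_nonpos.mpr ?_)
      refine (sum_sq_logOdds_le hX0 (hX i) δ).trans (le_mul_of_one_le_right (by positivity) ?_)
      have h1 : (∑ t, |r t|) ^ 2 ≤ T * ∑ t, r t ^ 2 := by
        have := sq_sum_le_card_mul_sum_sq (s := Finset.univ) (f := fun t => |r t|)
        simpa using this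
      have h2 : (pmin / 2) ^ 2 ≤ (∑ t, |r t|) ^ 2 :=
        pow_le_pow_left₀ (by positivity) hbad.le 2
      rw [div_mul_eq_mul_div, one_le_div (by positivity)]
      change pmin ^ 2 ≤ 4 * T * ∑ t, r t ^ 2
      nlinarith
  have hmean := empMean_mono hpt
  simp only [empMean_const_mul, empMean_sub] at hmean
  rw [← sq_fitNorm, ← hq, empMean_sum] at hmean
  set E := empMean fun i => logitBregman (logOdds γ (x i)) (logOdds δ (x i)) with hE
  have hE0 : 0 ≤ E := empMean_nonneg fun i => logitBregman_nonneg _ _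
  have hsum : ∑ t, empMean (fun i => (mlogit (logOdds γ (x i)) t - π i t) ^ 2) ≤ T * b ^ 2 := by
    calc _ ≤ ∑ _t : Fin T, b ^ 2 := Finset.sum_le_sum fun t _ => hbias t
      _ = _ := by simp
  have hmse0 : 0 ≤ ∑ t, empMean (fun i => (mlogit (logOdds γ (x i)) t - π i t) ^ 2) :=
    Finset.sum_nonneg fun t _ => empMean_nonneg fun i => sq_nonneg _
  -- The smallness of N b is calibrated so that bad observations consume at most half of q².
  have hloss : X ^ 2 * l ^ 2 * (4 * T / pmin ^ 2 *
      ∑ t, empMean (fun i => (mlogit (logOdds γ (x i)) t - π i t) ^ 2)) ≤ q ^ 2 / 2 := by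
    calc _ ≤ X ^ 2 * (N * q) ^ 2 * (4 * T / pmin ^ 2 * (T * b ^ 2)) := by gcongr
      _ = (8 * (T * X * N * b) ^ 2) / pmin ^ 2 * (q ^ 2 / 2) := by field_simp; ring
      _ ≤ 1 * (q ^ 2 / 2) := by
          gcongr
          rw [div_le_one (by positivity)]; exact hsmall
      _ = _ := one_mul _
  have hc : 0 ≤ (pmin / 2) ^ 2 / (8 * (1 + B)) := by positivity
  have h1 : (pmin / 2) ^ 2 / (8 * (1 + B)) * (q ^ 2 / 2) ≤ E :=
    (mul_le_mul_of_nonneg_left (by linarith) hc).trans hmean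
  have h2 : pmin ^ 2 / 64 * q ^ 2 ≤ (1 + B) * E := by
    calc _ = (1 + B) * ((pmin / 2) ^ 2 / (8 * (1 + B)) * (q ^ 2 / 2)) := by field_simp; ring
      _ ≤ _ := mul_le_mul_of_nonneg_left h1 (by positivity)
  refine h2.trans (mul_le_mul_of_nonneg_right ?_ hE0)
  linarith [mul_le_mul_of_nonneg_left hN hX0]

/-- If q > e, the only term on the right quadratic in q is M e B q², absorbed into half of the left
side. Everything else is at most (2A + B) e q. -/
theorem le_mul_of_quadratic {c A B M e q : ℝ} (hc : 0 < c) (hA : 0 ≤ A) (hB : 0 ≤ B)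
    (he : 0 ≤ e) (hM : M * e ≤ 1) (hMB : M * e * B ≤ c / 2)
    (h : c * q ^ 2 ≤ (1 + M * q) * (A * e ^ 2 + B * e * q)) :
    q ≤ (1 + 2 * (2 * A + B) / c) * e := by
  rcases le_or_gt q e with hqe | hqe
  · nlinarith [show 0 ≤ 2 * (2 * A + B) / c * e by positivity]
  · have hq0 : 0 < q := he.trans_lt hqe
    have h1 : c / 2 * q ^ 2 ≤ A * e ^ 2 + (A + B) * e * q := by
      have h2 : M * e * B * q ^ 2 ≤ c / 2 * q ^ 2 := by gcongr
      have h3 : M * e * (A * e * q) ≤ 1 * (A * e * q) := by gcongr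
      nlinarith
    have h4 : A * e ^ 2 ≤ A * e * q := by nlinarith [mul_nonneg hA he]
    have h5 : c / 2 * q ≤ (2 * A + B) * e := by
      refine le_of_mul_le_mul_right ?_ hq0
      nlinarith
    have h6 : q ≤ 2 * (2 * A + B) / c * e := by
      rw [div_mul_eq_mul_div, le_div_iff₀ hc]; linarith
    linarith

/-- Estimation error in prediction norm of an approximate minimizer. -/
theorem fitNorm_le_of_loss_le {X pmin σ b N U A B e : ℝ} (hX0 : 0 ≤ X)
    (hX : ∀ i j, |x i j| ≤ X) (hpmin : 0 < pmin) (hπ : ∀ i t, pmin ≤ π i t)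
    (hπ0 : ∀ i, pmin ≤ 1 - ∑ t, π i t) (hσ : ∀ t j, |score x d π t j| ≤ σ) (hb : 0 ≤ b)
    (hbias : ∀ t, fitMSE x π γ t ≤ b ^ 2) (hN0 : 0 ≤ N)
    (hN : absSum δ ≤ N * fitNorm x δ) (hsmall : 8 * (T * X * N * b) ^ 2 ≤ pmin ^ 2)
    (hU : mlogitLoss x d (γ + δ) ≤ mlogitLoss x d γ + U)
    (hA : 0 ≤ A) (hB : 0 ≤ B) (he : 0 ≤ e)
    (hbound : U + σ * absSum δ + T * b * fitNorm x δ ≤ A * e ^ 2 + B * e * fitNorm x δ)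
    (hM : X * N * e ≤ 1) (hMB : X * N * e * B ≤ pmin ^ 2 / 128) :
    fitNorm x δ ≤ (1 + 2 * (2 * A + B) / (pmin ^ 2 / 64)) * e := by
  have hq := fitNorm_nonneg x δ
  refine le_mul_of_quadratic (by positivity) hA hB he hM (by linarith) ?_
  refine (sq_fitNorm_le_bregman hX0 hX hpmin hπ hπ0 hbias hN hsmall).trans ?_
  rw [← mul_assoc]
  exact mul_le_mul_of_nonneg_left
    ((empMean_logitBregman_le hσ hb hbias hU).trans hbound) (by positivity)

theorem abs_mlogit_logOdds_add_sub_le (γ δ : Fin T → Fin p → ℝ) (xi : Fin p → ℝ)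
    (t : Fin T) :
    |mlogit (logOdds (γ + δ) xi) t - mlogit (logOdds γ xi) t|
      ≤ 2 * Real.sqrt (∑ u, logOdds δ xi u ^ 2) := by
  rw [logOdds_add]
  exact abs_mlogit_sub_le _ _ (fun u => Real.abs_le_sqrt (Finset.single_le_sum
    (f := fun u => logOdds δ xi u ^ 2) (fun _ _ => sq_nonneg _) (Finset.mem_univ u))) t

theorem fitMSE_add_le (x : Fin n → Fin p → ℝ) (π : Fin n → Fin T → ℝ)
    (γ δ : Fin T → Fin p → ℝ) (t : Fin T) :
    fitMSE x π (γ + δ) t ≤ 2 * fitMSE x π γ t + 8 * fitNorm x δ ^ 2 := by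
  rw [fitMSE, fitMSE, sq_fitNorm, ← empMean_const_mul, ← empMean_const_mul, ← empMean_add]
  refine empMean_mono fun i => ?_
  have h1 := abs_mlogit_logOdds_add_sub_le γ δ (x i) t
  have h2 := pow_le_pow_left₀ (abs_nonneg _) h1 2
  rw [sq_abs, mul_pow, Real.sq_sqrt (Finset.sum_nonneg fun _ _ => sq_nonneg _)] at h2
  nlinarith [sq_nonneg ((mlogit (logOdds (γ + δ) (x i)) t - mlogit (logOdds γ (x i)) t)
    - (mlogit (logOdds γ (x i)) t - π i t))]

end Loss

/-! ### Sparse eigenvalues of Gram matrices -/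

section SparseEig

variable {n T p : ℕ} {x : Fin n → Fin p → ℝ} {X : ℝ}

theorem sq_sum_abs_le_card_mul {S : Finset (Fin p)} {v : Fin p → ℝ}
    (hv : ∀ j, j ∉ S → v j = 0) : (∑ j, |v j|) ^ 2 ≤ S.card * ∑ j, v j ^ 2 := by
  have h1 : ∑ j, |v j| = ∑ j ∈ S, |v j| :=
    (Finset.sum_subset (Finset.subset_univ S) fun j _ hj => by simp [hv j hj]).symm
  rw [h1]
  calc (∑ j ∈ S, |v j|) ^ 2 ≤ S.card * ∑ j ∈ S, |v j| ^ 2 := sq_sum_le_card_mul_sum_sq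
    _ ≤ S.card * ∑ j, v j ^ 2 := by
        simp only [sq_abs]
        exact mul_le_mul_of_nonneg_left (Finset.sum_le_sum_of_subset_of_nonneg
          (Finset.subset_univ S) fun _ _ _ => sq_nonneg _) (Nat.cast_nonneg _)

theorem quadForm_gram_le (hX : ∀ i j, |x i j| ≤ X) {S : Finset (Fin p)}
    {v : Fin p → ℝ} (hv : ∀ j, j ∉ S → v j = 0) :
    quadForm (gram x) v ≤ X ^ 2 * S.card * ∑ j, v j ^ 2 := by
  rw [quadForm_gram]
  refine empMean_le_of_le (mul_nonneg (by positivity)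
    (Finset.sum_nonneg fun _ _ => sq_nonneg _)) fun i => ?_
  have h1 : |∑ j, x i j * v j| ≤ X * ∑ j, |v j| := by
    rw [Finset.mul_sum]
    refine (Finset.abs_sum_le_sum_abs _ _).trans (Finset.sum_le_sum fun j _ => ?_)
    rw [abs_mul]; exact mul_le_mul_of_nonneg_right (hX i j) (abs_nonneg _)
  calc (∑ j, x i j * v j) ^ 2 = |∑ j, x i j * v j| ^ 2 := (sq_abs _).symm
    _ ≤ (X * ∑ j, |v j|) ^ 2 := pow_le_pow_left₀ (abs_nonneg _) h1 2
    _ = X ^ 2 * (∑ j, |v j|) ^ 2 := mul_pow _ _ _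
    _ ≤ X ^ 2 * (S.card * ∑ j, v j ^ 2) :=
        mul_le_mul_of_nonneg_left (sq_sum_abs_le_card_mul hv) (sq_nonneg _)
    _ = _ := by ring

theorem sum_sq_pos {v : Fin p → ℝ} (hv : v ≠ 0) : 0 < ∑ j, v j ^ 2 := by
  obtain ⟨j, hj⟩ := Function.ne_iff.mp hv
  exact Finset.sum_pos' (fun _ _ => sq_nonneg _)
    ⟨j, Finset.mem_univ _, pow_pos (abs_pos.mpr hj) 2 |>.trans_eq (sq_abs _)⟩

theorem le_of_mem_rayleighSet (hX : ∀ i j, |x i j| ≤ X) {S : Finset (Fin p)}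
    {r : ℝ} (hr : r ∈ rayleighSet (gram x) S) : r ≤ X ^ 2 * S.card := by
  obtain ⟨v, hv, hvS, rfl⟩ := hr
  rw [div_le_iff₀ (sum_sq_pos hv)]
  exact quadForm_gram_le hX hvS

theorem nonneg_of_mem_rayleighSet {S : Finset (Fin p)}
    {r : ℝ} (hr : r ∈ rayleighSet (gram x) S) : 0 ≤ r := by
  obtain ⟨v, hv, hvS, rfl⟩ := hr
  exact div_nonneg (quadForm_gram_nonneg x v) (sum_sq_pos hv).le

theorem quadForm_le_sparseEigMax (hX : ∀ i j, |x i j| ≤ X)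
    {S : Finset (Fin p)} {v : Fin p → ℝ} (hv : ∀ j, j ∉ S → v j = 0) :
    quadForm (gram x) v ≤ sparseEigMax (gram x) S ^ 2 * ∑ j, v j ^ 2 := by
  rcases eq_or_ne v 0 with rfl | h0
  · simp [quadForm]
  have hmem : quadForm (gram x) v / ∑ j, v j ^ 2 ∈ rayleighSet (gram x) S :=
    ⟨v, h0, hv, rfl⟩
  rw [← div_le_iff₀ (sum_sq_pos h0)]
  have hbdd : BddAbove (rayleighSet (gram x) S) :=
    ⟨_, fun r hr => le_of_mem_rayleighSet hX hr⟩
  rw [sparseEigMax, Real.sq_sqrt (Real.sSup_nonneg fun r hr => nonneg_of_mem_rayleighSet hr)]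
  exact le_csSup hbdd hmem

theorem sparseEigMin_le_quadForm {S : Finset (Fin p)} {c : ℝ} (hc : 0 < c)
    (hS : c ≤ sparseEigMin (gram x) S) {v : Fin p → ℝ} (hv : ∀ j, j ∉ S → v j = 0) :
    c ^ 2 * ∑ j, v j ^ 2 ≤ quadForm (gram x) v := by
  rcases eq_or_ne v 0 with rfl | h0
  · simp [quadForm]
  have hmem : quadForm (gram x) v / ∑ j, v j ^ 2 ∈ rayleighSet (gram x) S :=
    ⟨v, h0, hv, rfl⟩
  rw [← le_div_iff₀ (sum_sq_pos h0)]
  rw [sparseEigMin, Real.le_sqrt' hc] at hS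
  exact hS.trans (csInf_le ⟨0, fun r hr => nonneg_of_mem_rayleighSet hr⟩ hmem)

theorem sparseEigMax_le_sqrt_card (hX0 : 0 ≤ X) (hX : ∀ i j, |x i j| ≤ X)
    (S : Finset (Fin p)) : sparseEigMax (gram x) S ≤ X * Real.sqrt S.card := by
  rw [sparseEigMax, ← Real.sqrt_sq hX0, ← Real.sqrt_mul (sq_nonneg X)]
  exact Real.sqrt_le_sqrt (Real.sSup_le (fun r hr => le_of_mem_rayleighSet hX hr)
    (by positivity))

/-- Besides making the supremum finite, this crude growth rate is what later places m = n in the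
index set. -/
theorem sparseEigMaxCard_le (hX0 : 0 ≤ X) (hX : ∀ i j, |x i j| ≤ X) (m : ℕ) :
    sparseEigMaxCard (gram x) m ≤ X * Real.sqrt m := by
  refine Real.sSup_le ?_ (by positivity)
  rintro r ⟨S, hS, rfl⟩
  refine (sparseEigMax_le_sqrt_card hX0 hX S).trans ?_
  gcongr

theorem sparseEigMax_le_sparseEigMaxCard (hX0 : 0 ≤ X) (hX : ∀ i j, |x i j| ≤ X)
    {S : Finset (Fin p)} {m : ℕ} (hS : S.card ≤ m) :
    sparseEigMax (gram x) S ≤ sparseEigMaxCard (gram x) m := by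
  refine le_csSup ⟨X * Real.sqrt m, ?_⟩ ⟨S, hS, rfl⟩
  rintro r ⟨S', hS', rfl⟩
  refine (sparseEigMax_le_sqrt_card hX0 hX S').trans ?_
  gcongr

theorem sum_abs_le_fitNorm {S : Finset (Fin p)} {c k : ℝ} (hc : 0 < c) (hk : S.card ≤ k)
    (hS : S.Nonempty → c ≤ sparseEigMin (gram x) S) {δ : Fin T → Fin p → ℝ}
    (hδ : ∀ t j, j ∉ S → δ t j = 0) (t : Fin T) :
    ∑ j, |δ t j| ≤ Real.sqrt k / c * fitNorm x δ := by
  have hk0 : 0 ≤ k := (Nat.cast_nonneg _).trans hk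
  -- An empty S has no Rayleigh quotients, so its eigenvalue is a default value; there δ vanishes
  -- and nothing is needed.
  rcases S.eq_empty_or_nonempty with rfl | hne
  · simp only [hδ t _ (Finset.notMem_empty _), abs_zero, Finset.sum_const_zero]
    exact mul_nonneg (by positivity) (fitNorm_nonneg _ _)
  have h1 := sq_sum_abs_le_card_mul (hδ t)
  have h2 := sparseEigMin_le_quadForm hc (hS hne) (hδ t)
  have h3 : quadForm (gram x) (δ t) ≤ fitNorm x δ ^ 2 := by
    rw [← sum_quadForm_gram]
    exact Finset.single_le_sum (f := fun t => quadForm (gram x) (δ t))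
      (fun _ _ => quadForm_gram_nonneg _ _) (Finset.mem_univ t)
  refine (le_abs_self _).trans (abs_le_of_sq_le_sq ?_ <|
    mul_nonneg (by positivity) (fitNorm_nonneg _ _))
  rw [mul_pow, div_pow, Real.sq_sqrt hk0]
  calc _ ≤ _ := h1
    _ ≤ k * ∑ j, δ t j ^ 2 := by gcongr
    _ = k / c ^ 2 * (c ^ 2 * ∑ j, δ t j ^ 2) := by field_simp
    _ ≤ _ := mul_le_mul_of_nonneg_left (h2.trans h3) (by positivity)

theorem absSum_le_fitNorm {S : Finset (Fin p)} {c k : ℝ} (hc : 0 < c) (hk : S.card ≤ k)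
    (hS : S.Nonempty → c ≤ sparseEigMin (gram x) S) {δ : Fin T → Fin p → ℝ}
    (hδ : ∀ t j, j ∉ S → δ t j = 0) :
    absSum δ ≤ T * (Real.sqrt k / c) * fitNorm x δ := by
  calc absSum δ ≤ ∑ _t : Fin T, Real.sqrt k / c * fitNorm x δ :=
        Finset.sum_le_sum fun t _ => sum_abs_le_fitNorm hc hk hS hδ t
    _ = _ := by simp; ring

end SparseEig

/-! ### The group lasso estimate -/

section Lasso

variable {n T p : ℕ} {x : Fin n → Fin p → ℝ} {d : Fin n → Fin (T + 1)}
  {π : Fin n → Fin T → ℝ} {γ δ : Fin T → Fin p → ℝ} {lam : ℝ}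

/-- The basic inequality: off the support of γ the penalty of γ + δ equals that of δ, and on it the
triangle inequality applies. -/
theorem mlogitLoss_lasso_le (hlam : 0 ≤ lam) (h : IsGroupLasso x d lam (γ + δ)) :
    mlogitLoss x d (γ + δ) ≤ mlogitLoss x d γ
      + lam * (mixedNormOn (suppUnion γ) δ - mixedNormOn (suppUnion γ)ᶜ δ) := by
  have h1 := h γ
  have h2 : mixedNormOn Finset.univ γ - mixedNormOn Finset.univ (γ + δ)
      ≤ mixedNormOn (suppUnion γ) δ - mixedNormOn (suppUnion γ)ᶜ δ := by
    rw [← mixedNormOn_add_compl (suppUnion γ) γ, ← mixedNormOn_add_compl (suppUnion γ) (γ + δ)]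
    have h3 : mixedNormOn (suppUnion γ) γ
        ≤ mixedNormOn (suppUnion γ) (γ + δ) + mixedNormOn (suppUnion γ) δ := by
      simp only [mixedNormOn_eq, ← Finset.sum_add_distrib]
      refine Finset.sum_le_sum fun j _ => ?_
      have := colNorm_add_le (γ + δ) (-δ) j
      rwa [colNorm_neg, add_neg_cancel_right] at this
    have h4 : mixedNormOn (suppUnion γ)ᶜ γ = 0 := by
      refine Finset.sum_eq_zero fun j hj => ?_
      simp [eq_zero_of_notMem_suppUnion (Finset.mem_compl.mp hj)]
    have h5 : mixedNormOn (suppUnion γ)ᶜ (γ + δ) = mixedNormOn (suppUnion γ)ᶜ δ := by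
      refine Finset.sum_congr rfl fun j hj => ?_
      simp [eq_zero_of_notMem_suppUnion (Finset.mem_compl.mp hj)]
    linarith
  nlinarith

theorem mixedNormOn_le_of_isRestrictedEigenvalue {S : Finset (Fin p)} {κ κ₀ : ℝ}
    (hκ₀ : 0 < κ₀) (hκ : κ₀ ≤ κ) (hre : IsRestrictedEigenvalue T (gram x) S κ)
    (hcone : mixedNormOn Sᶜ δ ≤ 4 * mixedNormOn S δ) :
    mixedNormOn S δ ≤ Real.sqrt S.card / κ₀ * fitNorm x δ := by
  have h1 : mixedNormOn S δ ^ 2 ≤ S.card * ∑ t, ∑ j ∈ S, δ t j ^ 2 := by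
    calc mixedNormOn S δ ^ 2 ≤ S.card * ∑ j ∈ S, colNorm δ j ^ 2 := sq_sum_le_card_mul_sum_sq
      _ = _ := by simp only [sq_colNorm]; rw [Finset.sum_comm]
  have h2 : κ ^ 2 * ∑ t, ∑ j ∈ S, δ t j ^ 2 ≤ fitNorm x δ ^ 2 := by
    rcases eq_or_ne δ 0 with rfl | h0
    · simp only [Pi.zero_apply, ne_eq, OfNat.ofNat_ne_zero, not_false_eq_true, zero_pow,
        Finset.sum_const_zero, mul_zero]; positivity
    have h3 := hre δ h0 hcone
    rw [sum_quadForm_gram] at h3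
    have h4 : 0 ≤ ∑ t, ∑ j ∈ S, δ t j ^ 2 :=
      Finset.sum_nonneg fun _ _ => Finset.sum_nonneg fun _ _ => sq_nonneg _
    exact mul_le_of_le_div₀ (sq_nonneg _) h4 h3
  have h5 : κ₀ ^ 2 ≤ κ ^ 2 := pow_le_pow_left₀ hκ₀.le hκ 2
  refine (le_abs_self _).trans (abs_le_of_sq_le_sq ?_ <|
    mul_nonneg (by positivity) (fitNorm_nonneg _ _))
  rw [mul_pow, div_pow, Real.sq_sqrt (Nat.cast_nonneg _)]
  have h4 : 0 ≤ ∑ t, ∑ j ∈ S, δ t j ^ 2 :=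
    Finset.sum_nonneg fun _ _ => Finset.sum_nonneg fun _ _ => sq_nonneg _
  calc _ ≤ _ := h1
    _ = S.card / κ₀ ^ 2 * (κ₀ ^ 2 * ∑ t, ∑ j ∈ S, δ t j ^ 2) := by field_simp
    _ ≤ S.card / κ₀ ^ 2 * (κ ^ 2 * ∑ t, ∑ j ∈ S, δ t j ^ 2) := by gcongr
    _ ≤ _ := mul_le_mul_of_nonneg_left h2 (by positivity)

theorem score_term_le (hT : 1 ≤ T) (hlam : 0 ≤ lam) (δ : Fin T → Fin p → ℝ) :
    lam / (8 * T) * absSum δ ≤ lam / 8 * mixedNormOn Finset.univ δ := by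
  have hT' : (0 : ℝ) < T := by exact_mod_cast hT
  calc lam / (8 * T) * absSum δ ≤ lam / (8 * T) * (T * mixedNormOn Finset.univ δ) :=
        mul_le_mul_of_nonneg_left (absSum_le_mul_mixedNormOn δ) (by positivity)
    _ = _ := by field_simp

/-- The estimation error of the group lasso is controlled by its prediction norm, whether or not
it lies in the restricted-eigenvalue cone. -/
theorem mixedNormOn_lasso_le {b κ κ₀ Cb : ℝ} (hT : 1 ≤ T) (hlam : 0 < lam)
    (h : IsGroupLasso x d lam (γ + δ)) (hσ : ∀ t j, |score x d π t j| ≤ lam / (8 * T))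
    (hb : 0 ≤ b) (hbias : ∀ t, fitMSE x π γ t ≤ b ^ 2) (hκ₀ : 0 < κ₀) (hκ : κ₀ ≤ κ)
    (hre : IsRestrictedEigenvalue T (gram x) (suppUnion γ) κ) (hCb : 0 ≤ Cb)
    (hbl : b ≤ Cb * (lam * Real.sqrt (suppUnion γ).card)) :
    mixedNormOn Finset.univ δ
      ≤ (5 / κ₀ + 3 * T * Cb) * Real.sqrt (suppUnion γ).card * fitNorm x δ := by
  set S := suppUnion γ with hS
  have hq := fitNorm_nonneg x δ
  have h1 := empMean_logitBregman_le hσ hb hbias (mlogitLoss_lasso_le hlam.le h)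
  have h2 := empMean_nonneg fun i => logitBregman_nonneg (logOdds γ (x i)) (logOdds δ (x i))
  have h3 := score_term_le hT hlam.le δ
  rw [← mixedNormOn_add_compl S] at h3 ⊢
  have ha := mixedNormOn_nonneg S δ
  have hc := mixedNormOn_nonneg Sᶜ δ
  rw [← hS] at h1
  set a := mixedNormOn S δ
  set c := mixedNormOn Sᶜ δ with hcdef
  set q := fitNorm x δ
  set r := Real.sqrt S.card with hr
  have hr0 : 0 ≤ r := Real.sqrt_nonneg _
  have hT0 : (0 : ℝ) ≤ T := Nat.cast_nonneg _
  rcases le_or_gt c (4 * a) with hcone | hcone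
  · have h4 : a ≤ r / κ₀ * q := mixedNormOn_le_of_isRestrictedEigenvalue hκ₀ hκ hre hcone
    have h5 : (5 / κ₀ + 3 * T * Cb) * r * q = 5 * (r / κ₀ * q) + 3 * T * Cb * r * q := by ring
    rw [h5]
    have : 0 ≤ 3 * T * Cb * r * q := by positivity
    linarith
  -- Outside the cone, nonnegativity of the divergence gives 0 ≤ (9/8) λ a - (7/8) λ c + T b q. With
  -- a < c/4 this leaves (19/32) λ c ≤ T b q, and a + c ≤ (5/4) c then fits within the factor 3.
  · have h4 : T * b * q ≤ lam * (T * Cb * r * q) := by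
      calc T * b * q ≤ T * (Cb * (lam * r)) * q := by gcongr
        _ = _ := by ring
    have h5 : lam * (19 / 32 * c) ≤ lam * (T * Cb * r * q) := by nlinarith
    have h6 := le_of_mul_le_mul_left h5 hlam
    have h7 : (5 / κ₀ + 3 * T * Cb) * r * q = 5 / κ₀ * r * q + 3 * (T * Cb * r * q) := by ring
    rw [h7]
    have : 0 ≤ 5 / κ₀ * r * q := by positivity
    linarith

/-- Uniform constants for `fitNorm_le_of_loss_le`. -/
theorem exists_fitNorm_le (T : ℕ) {X pmin K A B : ℝ} (hX0 : 0 ≤ X) (hpmin : 0 < pmin)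
    (hK : 0 ≤ K) (hA : 0 ≤ A) (hB : 0 ≤ B) :
    ∃ η C : ℝ, 0 < η ∧ 0 < C ∧ ∀ {n p : ℕ} {x : Fin n → Fin p → ℝ} {d : Fin n → Fin (T + 1)}
      {π : Fin n → Fin T → ℝ} {γ δ : Fin T → Fin p → ℝ} {σ b r U e : ℝ},
      (∀ i j, |x i j| ≤ X) → (∀ i t, pmin ≤ π i t) → (∀ i, pmin ≤ 1 - ∑ t, π i t) →
      (∀ t j, |score x d π t j| ≤ σ) → 0 ≤ b → (∀ t, fitMSE x π γ t ≤ b ^ 2) →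
      0 ≤ r → absSum δ ≤ K * r * fitNorm x δ →
      mlogitLoss x d (γ + δ) ≤ mlogitLoss x d γ + U → b ≤ e →
      U + σ * absSum δ + T * b * fitNorm x δ ≤ A * e ^ 2 + B * e * fitNorm x δ →
      r * e ≤ η → fitNorm x δ ≤ C * e := by
  -- With N = K r and b ≤ e, each smallness requirement reads r e times a constant ≤ 1; G dominates
  -- all three constants. The factor 3 covers the 8 in the bias condition, as 9 ≥ 8.
  set G := 1 + X * K + X * K * B * (128 / pmin ^ 2) + 3 * (T * X * K) / pmin with hG
  have g1 : 0 ≤ X * K := by positivity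
  have g2 : 0 ≤ X * K * B * (128 / pmin ^ 2) := by positivity
  have g3 : 0 ≤ 3 * (T * X * K) / pmin := by positivity
  have hG0 : 0 < G := by linarith
  refine ⟨1 / G, 1 + 2 * (2 * A + B) / (pmin ^ 2 / 64), by positivity, by positivity, ?_⟩
  intro n p x d π γ δ σ b r U e hX hπ hπ0 hσ hb hbias hr hN hU hbe hbound hre
  have he : 0 ≤ e := hb.trans hbe
  have hre0 : 0 ≤ r * e := mul_nonneg hr he
  rw [le_div_iff₀ hG0] at hre
  have k1 : r * e * (X * K) ≤ 1 := (mul_le_mul_of_nonneg_left (by linarith) hre0).trans hre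
  have k2 : r * e * (X * K * B * (128 / pmin ^ 2)) ≤ 1 :=
    (mul_le_mul_of_nonneg_left (by linarith) hre0).trans hre
  have k3 : r * e * (3 * (T * X * K) / pmin) ≤ 1 :=
    (mul_le_mul_of_nonneg_left (by linarith) hre0).trans hre
  refine fitNorm_le_of_loss_le hX0 hX hpmin hπ hπ0 hσ hb hbias (by positivity) hN ?_ hU hA hB he
    hbound (by linarith) ?_
  · have k4 : 3 * (T * X * (K * r) * b) ≤ pmin := by
      calc 3 * (T * X * (K * r) * b) ≤ 3 * (T * X * (K * r) * e) := by gcongr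
        _ = r * e * (3 * (T * X * K) / pmin) * pmin := by field_simp
        _ ≤ 1 * pmin := by gcongr
        _ = pmin := one_mul _
    have k5 := pow_le_pow_left₀ (by positivity) k4 2
    nlinarith [sq_nonneg (T * X * (K * r) * b)]
  · calc X * (K * r) * e * B = r * e * (X * K * B * (128 / pmin ^ 2)) * (pmin ^ 2 / 128) := by
          field_simp
      _ ≤ 1 * (pmin ^ 2 / 128) := by gcongr
      _ = _ := one_mul _

theorem fitMSE_nonneg (x : Fin n → Fin p → ℝ) (π : Fin n → Fin T → ℝ)
    (γ : Fin T → Fin p → ℝ) (t : Fin T) : 0 ≤ fitMSE x π γ t :=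
  empMean_nonneg fun _ => sq_nonneg _

theorem abs_lossGrad_add_sub_le {X : ℝ} (hX0 : 0 ≤ X) (hX : ∀ i j, |x i j| ≤ X) (t : Fin T)
    (j : Fin p) :
    |lossGrad x d (γ + δ) t j - lossGrad x d γ t j| ≤ 2 * X ^ 2 * absSum δ := by
  rw [lossGrad, lossGrad, ← empMean_sub]
  refine (abs_empMean_le _).trans (empMean_le_of_le
    (mul_nonneg (by positivity) (absSum_nonneg δ)) fun i => ?_)
  have h1 := abs_mlogit_logOdds_add_sub_le γ δ (x i) t
  have h2 : Real.sqrt (∑ u, logOdds δ (x i) u ^ 2) ≤ X * absSum δ := by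
    refine Real.sqrt_le_iff.mpr ⟨mul_nonneg hX0 (absSum_nonneg δ), ?_⟩
    rw [mul_pow]; exact sum_sq_logOdds_le hX0 (hX i) δ
  rw [← mul_sub, sub_sub_sub_cancel_right, abs_mul]
  calc _ ≤ X * (2 * (X * absSum δ)) :=
        mul_le_mul (hX i j) (h1.trans (by linarith)) (abs_nonneg _) hX0
    _ = _ := by ring

/-- First-order condition of the group lasso at a selected covariate. -/
theorem le_colNorm_lossGrad {X : ℝ} (hX0 : 0 ≤ X) (hX : ∀ i j, |x i j| ≤ X)
    (h : IsGroupLasso x d lam γ) {j : Fin p} (hj : j ∈ suppUnion γ) :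
    lam ≤ colNorm (lossGrad x d γ) j := by
  have hc : 0 < colNorm γ j := mem_suppUnion.mp hj
  set v : Fin T → Fin p → ℝ := fun t k => if k = j then γ t j else 0 with hv
  have hvj : ∀ f : Fin T → Fin p → ℝ, ∑ t, ∑ k, f t k * v t k = ∑ t, f t j * γ t j := fun f =>
    Finset.sum_congr rfl fun t _ => by simp [hv]
  set M := 2 * X ^ 2 * absSum v * ∑ t, |γ t j| with hM
  -- Shrinking column j by 1 - τ lowers the penalty by exactly τ times its norm. Minimality and
  -- convexity at the shrunken point bound this by the gradient there; Lipschitz continuity moves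
  -- the gradient back to γ at cost M τ, which vanishes as τ → 0.
  have key : ∀ τ : ℝ, 0 < τ → τ ≤ 1 →
      lam * colNorm γ j ≤ -(∑ t, lossGrad x d γ t j * γ t j) + M * τ := by
    intro τ h0 h1
    set γ' := γ + (-τ) • v with hγ'
    have hγ : γ' + τ • v = γ := by rw [hγ']; simp
    have hnorm : mixedNormOn Finset.univ γ' = mixedNormOn Finset.univ γ - τ * colNorm γ j := by
      rw [mixedNormOn_eq, mixedNormOn_eq, ← Finset.add_sum_erase _ _ (Finset.mem_univ j),
        ← Finset.add_sum_erase _ (colNorm γ) (Finset.mem_univ j)]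
      have e1 : colNorm γ' j = (1 - τ) * colNorm γ j := by
        have e2 : ∀ t, γ' t j = (1 - τ) * γ t j := fun t => by simp [hγ', hv]; ring
        simp only [colNorm, e2, mul_pow, ← Finset.mul_sum]
        rw [Real.sqrt_mul (sq_nonneg _), Real.sqrt_sq (by linarith)]
      have e3 : ∑ k ∈ Finset.univ.erase j, colNorm γ' k
          = ∑ k ∈ Finset.univ.erase j, colNorm γ k :=
        Finset.sum_congr rfl fun k hk => by
          simp [colNorm, hγ', hv, Finset.ne_of_mem_erase hk]
      rw [e1, e3]; ring
    have h2 := h γ'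
    have h3 := mlogitLoss_add_ge x d γ' (τ • v)
    rw [hγ] at h3
    have h4 : ∑ t, ∑ k, lossGrad x d γ' t k * (τ • v) t k
        = τ * ∑ t, lossGrad x d γ' t j * γ t j := by
      rw [← hvj, Finset.mul_sum]
      refine Finset.sum_congr rfl fun t _ => ?_
      rw [Finset.mul_sum]
      refine Finset.sum_congr rfl fun k _ => ?_
      simp only [Pi.smul_apply, smul_eq_mul]; ring
    have h5 : lam * colNorm γ j ≤ -∑ t, lossGrad x d γ' t j * γ t j := by
      rw [hnorm] at h2
      rw [h4] at h3
      refine le_of_mul_le_mul_left ?_ h0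
      nlinarith
    have h6 : absSum ((-τ) • v) = τ * absSum v := by
      simp only [absSum, Pi.smul_apply, smul_eq_mul, abs_mul, abs_neg, abs_of_pos h0,
        Finset.mul_sum]
    have h7 : ∑ t, (lossGrad x d γ t j - lossGrad x d γ' t j) * γ t j ≤ M * τ := by
      calc _ ≤ ∑ t, (2 * X ^ 2 * (τ * absSum v)) * |γ t j| := Finset.sum_le_sum fun t _ => by
            refine (le_abs_self _).trans ?_
            rw [abs_mul, abs_sub_comm, hγ', ← h6]
            exact mul_le_mul_of_nonneg_right (abs_lossGrad_add_sub_le hX0 hX t j) (abs_nonneg _)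
        _ = _ := by rw [← Finset.mul_sum, hM]; ring
    simp only [sub_mul, Finset.sum_sub_distrib] at h7
    linarith
  have hlim : lam * colNorm γ j ≤ -(∑ t, lossGrad x d γ t j * γ t j) := by
    have ht : Tendsto (fun τ : ℝ => -(∑ t, lossGrad x d γ t j * γ t j) + M * τ) (𝓝[>] 0)
        (𝓝 (-(∑ t, lossGrad x d γ t j * γ t j) + M * 0)) :=
      ((continuous_const.add (continuous_const.mul continuous_id)).tendsto 0).mono_left
        nhdsWithin_le_nhds
    rw [mul_zero, add_zero] at ht
    refine ge_of_tendsto ht ?_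
    filter_upwards [Ioc_mem_nhdsGT (zero_lt_one' ℝ)] with τ hτ using key τ hτ.1 hτ.2
  have hcs : -(∑ t, lossGrad x d γ t j * γ t j) ≤ colNorm (lossGrad x d γ) j * colNorm γ j := by
    refine (neg_le_abs _).trans ?_
    rw [colNorm, colNorm, ← Real.sqrt_mul (Finset.sum_nonneg fun _ _ => sq_nonneg _)]
    exact Real.abs_le_sqrt (Finset.sum_mul_sq_le_sq_mul_sq _ _ _)
  exact le_of_mul_le_mul_right (hlim.trans hcs) hc

/-- Empirical sparsity of the group lasso in terms of its fit. -/
theorem card_mul_sq_le {X φ : ℝ} (hT : 1 ≤ T) (hlam : 0 < lam) (hX0 : 0 ≤ X)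
    (hX : ∀ i j, |x i j| ≤ X) (h : IsGroupLasso x d lam γ)
    (hσ : ∀ t j, |score x d π t j| ≤ lam / (8 * T)) {A : Finset (Fin p)}
    (hA : A ⊆ suppUnion γ) (hφ : sparseEigMax (gram x) A ≤ φ) :
    A.card * lam ^ 2 ≤ 4 * T * φ ^ 2 * ∑ t, fitMSE x π γ t := by
  have hT' : (0 : ℝ) < T := by exact_mod_cast hT
  set a : Fin T → Fin p → ℝ := fun t j =>
    empMean fun i => x i j * (mlogit (logOdds γ (x i)) t - π i t) with ha
  -- The score takes up at most λ/8 of the gradient column, so the correlation with the fitted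
  -- residuals retains more than λ/2.
  have h1 : ∀ j ∈ A, lam / 2 ≤ ∑ t, |a t j| := fun j hj => by
    have h2 := (le_colNorm_lossGrad hX0 hX h (hA hj)).trans (colNorm_le_sum_abs _ _)
    have h3 : ∑ t, |lossGrad x d γ t j| ≤ ∑ t, (|a t j| + lam / (8 * T)) :=
      Finset.sum_le_sum fun t _ => by
        rw [lossGrad_eq x d π]
        exact (abs_sub _ _).trans (by linarith [hσ t j])
    rw [Finset.sum_add_distrib, Finset.sum_const, Finset.card_univ, Fintype.card_fin,
      nsmul_eq_mul] at h3
    have h4 : (T : ℝ) * (lam / (8 * T)) = lam / 8 := by field_simp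
    rw [h4] at h3
    linarith
  -- Duality: testing the correlations against themselves, v = a on A, gives s² ≤ MSE · v'Qv ≤ MSE ·
  -- φ² s, and one factor s cancels.
  have h5 : ∀ t, ∑ j ∈ A, a t j ^ 2 ≤ φ ^ 2 * fitMSE x π γ t := fun t => by
    set r : Fin n → ℝ := fun i => mlogit (logOdds γ (x i)) t - π i t with hr
    set v : Fin p → ℝ := fun j => if j ∈ A then a t j else 0 with hv
    set s := ∑ j ∈ A, a t j ^ 2 with hs
    have hs0 : 0 ≤ s := Finset.sum_nonneg fun _ _ => sq_nonneg _
    have h6 : s = empMean fun i => r i * ∑ j, x i j * v j := by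
      have : ∀ i, r i * ∑ j, x i j * v j = ∑ j ∈ A, (x i j * r i) * a t j := fun i => by
        rw [Finset.mul_sum, ← Finset.sum_filter_add_sum_filter_not Finset.univ (· ∈ A)]
        simp only [Finset.filter_mem_eq_inter, Finset.univ_inter]
        rw [Finset.sum_eq_zero (s := Finset.filter _ _)
          (fun j hj => by simp [hv, (Finset.mem_filter.mp hj).2]), add_zero]
        exact Finset.sum_congr rfl fun j hj => by simp only [hv, hj, if_true]; ring
      simp only [this, empMean_sum, empMean_mul_const]
      exact Finset.sum_congr rfl fun j _ => sq _
    have h7 := sq_empMean_mul_le r fun i => ∑ j, x i j * v j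
    rw [← h6, ← quadForm_gram] at h7
    have h8 : ∑ j, v j ^ 2 = s := by
      simp [hv, ite_pow, hs]
    have h9 := quadForm_le_sparseEigMax hX (S := A) (v := v) fun j hj => by simp [hv, hj]
    rw [h8] at h9
    have h10 : sparseEigMax (gram x) A ^ 2 ≤ φ ^ 2 :=
      pow_le_pow_left₀ (Real.sqrt_nonneg _) hφ 2
    have hm : 0 ≤ fitMSE x π γ t := fitMSE_nonneg _ _ _ _
    have h11 : s ^ 2 ≤ fitMSE x π γ t * (φ ^ 2 * s) :=
      h7.trans (mul_le_mul_of_nonneg_left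
        (h9.trans (mul_le_mul_of_nonneg_right h10 hs0)) hm)
    rcases hs0.eq_or_lt with h0 | h0
    · rw [← h0]; positivity
    · refine le_of_mul_le_mul_right ?_ h0
      nlinarith
  have h12 : A.card * (lam / 2) ^ 2 ≤ T * ∑ t, ∑ j ∈ A, a t j ^ 2 := by
    calc A.card * (lam / 2) ^ 2 = ∑ _j ∈ A, (lam / 2) ^ 2 := by simp
      _ ≤ ∑ j ∈ A, (∑ t, |a t j|) ^ 2 := Finset.sum_le_sum fun j hj =>
          pow_le_pow_left₀ (by positivity) (h1 j hj) 2
      _ ≤ ∑ j ∈ A, T * ∑ t, a t j ^ 2 := Finset.sum_le_sum fun j _ => by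
          have := sq_sum_le_card_mul_sum_sq (s := Finset.univ) (f := fun t => |a t j|)
          simpa using this
      _ = _ := by rw [← Finset.mul_sum, Finset.sum_comm]
  have h13 : ∑ t, ∑ j ∈ A, a t j ^ 2 ≤ φ ^ 2 * ∑ t, fitMSE x π γ t := by
    rw [Finset.mul_sum]; exact Finset.sum_le_sum fun t _ => h5 t
  nlinarith [mul_le_mul_of_nonneg_left h13 hT'.le]

end Lasso

/-! ### Events of probability approaching one -/

section Stochastic

variable {Ω : ℕ → Type*} [∀ n, MeasurableSpace (Ω n)] {μ : ∀ n, Measure (Ω n)}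

/-- The calculus of these events uses only monotonicity and subadditivity of the outer measure, so
the events and estimators need not be measurable. -/
theorem WPA1.inter {E F : ∀ n, Set (Ω n)} (hE : WPA1 μ E) (hF : WPA1 μ F) :
    WPA1 μ fun n => E n ∩ F n := by
  have h := hE.add hF
  rw [add_zero] at h
  refine tendsto_of_tendsto_of_tendsto_of_le_of_le tendsto_const_nhds h (fun _ => zero_le)
    fun n => ?_
  simp only [Set.compl_inter]
  exact measure_union_le _ _

theorem WPA1.mono {E F : ∀ n, Set (Ω n)} (hE : WPA1 μ E) (h : ∀ᶠ n in atTop, E n ⊆ F n) :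
    WPA1 μ F :=
  tendsto_of_tendsto_of_tendsto_of_le_of_le' tendsto_const_nhds hE
    (Eventually.of_forall fun _ => zero_le)
    (h.mono fun _ hn => measure_mono (Set.compl_subset_compl.mpr hn))

theorem wpa1_of_ae {E : ∀ n, Set (Ω n)} (h : ∀ n, ∀ᵐ ω ∂μ n, ω ∈ E n) : WPA1 μ E := by
  have : (fun n => μ n (E n)ᶜ) = fun _ => 0 := funext fun n => h n
  rw [WPA1, this]; exact tendsto_const_nhds

theorem WPA1.eventually_le {E : ∀ n, Set (Ω n)} (hE : WPA1 μ E) {ε : ℝ} (hε : 0 < ε) :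
    ∀ᶠ n in atTop, μ n (E n)ᶜ ≤ ENNReal.ofReal ε :=
  (hE.eventually (gt_mem_nhds (ENNReal.ofReal_pos.mpr hε))).mono fun _ h => h.le

theorem WPA1.eventually_nonempty [∀ n, IsProbabilityMeasure (μ n)] {E : ∀ n, Set (Ω n)}
    (hE : WPA1 μ E) : ∀ᶠ n in atTop, (E n).Nonempty := by
  filter_upwards [hE.eventually (gt_mem_nhds zero_lt_one)] with n hn
  rw [Set.nonempty_iff_ne_empty]
  intro h0
  rw [h0, Set.compl_empty, measure_univ] at hn
  exact lt_irrefl _ hn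

/-- If `Y = O_P(a)`, then bounds for `X` on events where `|Y| ≤ M a` give `X = O_P(a')`. -/
theorem IsOP.of_bound {X Y : ∀ n, Ω n → ℝ} {a a' : ℕ → ℝ} (hY : IsOP μ Y a)
    (h : ∀ M : ℝ, 0 < M → ∃ C : ℝ, 0 < C ∧
      WPA1 μ fun n => {ω | |Y n ω| ≤ M * a n → |X n ω| ≤ C * a' n}) :
    IsOP μ X a' := by
  intro ε hε
  obtain ⟨M, hM, hYM⟩ := hY (ε / 2) (half_pos hε)
  obtain ⟨C, hC, hE⟩ := h M hM
  refine ⟨C, hC, ?_⟩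
  filter_upwards [hYM, hE.eventually_le (half_pos hε)] with n h1 h2
  calc μ n {ω | C * a' n < |X n ω|}
      ≤ μ n ({ω | M * a n < |Y n ω|} ∪ {ω | |Y n ω| ≤ M * a n → |X n ω| ≤ C * a' n}ᶜ) := by
        refine measure_mono fun ω hω => ?_
        rcases lt_or_ge (M * a n) |Y n ω| with h3 | h3
        · exact Or.inl h3
        · exact Or.inr fun h4 => absurd (h4 h3) (not_le.mpr hω)
    _ ≤ ENNReal.ofReal (ε / 2) + ENNReal.ofReal (ε / 2) :=
        (measure_union_le _ _).trans (add_le_add h1 h2)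
    _ = ENNReal.ofReal ε := by
        rw [← ENNReal.ofReal_add (half_pos hε).le (half_pos hε).le, add_halves]

theorem IsOP.of_abs_le_add {X Y W : ∀ n, Ω n → ℝ} {a : ℕ → ℝ} (hX : IsOP μ X a)
    (hY : IsOP μ Y a) (h : ∀ n ω, |W n ω| ≤ |X n ω| + |Y n ω|) : IsOP μ W a := by
  intro ε hε
  obtain ⟨M, hM, hXM⟩ := hX (ε / 2) (half_pos hε)
  obtain ⟨M', hM', hYM⟩ := hY (ε / 2) (half_pos hε)
  refine ⟨M + M', add_pos hM hM', ?_⟩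
  filter_upwards [hXM, hYM] with n h1 h2
  calc μ n {ω | (M + M') * a n < |W n ω|}
      ≤ μ n ({ω | M * a n < |X n ω|} ∪ {ω | M' * a n < |Y n ω|}) := by
        refine measure_mono fun ω hω => ?_
        have hω' : (M + M') * a n < |W n ω| := hω
        by_contra hc
        rw [Set.mem_union, not_or] at hc
        have h3 : |X n ω| ≤ M * a n := not_lt.mp hc.1
        have h4 : |Y n ω| ≤ M' * a n := not_lt.mp hc.2
        linarith [h n ω]
    _ ≤ ENNReal.ofReal (ε / 2) + ENNReal.ofReal (ε / 2) :=
        (measure_union_le _ _).trans (add_le_add h1 h2)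
    _ = ENNReal.ofReal ε := by
        rw [← ENNReal.ofReal_add (half_pos hε).le (half_pos hε).le, add_halves]

theorem isOP_of_wpa1 {X : ∀ n, Ω n → ℝ} {a : ℕ → ℝ} {C : ℝ} (hC : 0 < C)
    (h : WPA1 μ fun n => {ω | |X n ω| ≤ C * a n}) : IsOP μ X a := by
  intro ε hε
  refine ⟨C, hC, (h.eventually_le hε).mono fun n hn => ?_⟩
  refine le_trans (measure_mono fun ω hω => ?_) hn
  have hω' : C * a n < |X n ω| := hω
  exact not_le.mpr hω'

end Stochastic

theorem ae_of_ae_fst {α β : Type*} [MeasurableSpace α] [MeasurableSpace β]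
    (P : Measure (α × β)) {q : α → Prop} (h : ∀ᵐ x ∂P.fst, q x) : ∀ᵐ z ∂P, q z.1 :=
  ae_of_ae_map measurable_fst.aemeasurable h

theorem ae_comp_fst_of_map_eq {Ω α β : Type*} [MeasurableSpace Ω] [MeasurableSpace α]
    [MeasurableSpace β] {μ : Measure Ω} {P : Measure (α × β)} {Z : Ω → α × β}
    (hZ : Measurable Z) (hlaw : μ.map Z = P) {q : α → Prop} (h : ∀ᵐ x ∂P.fst, q x) :
    ∀ᵐ ω ∂μ, q (Z ω).1 := by
  have h1 := ae_of_ae_fst P h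
  rw [← hlaw] at h1
  exact ae_of_ae_map hZ.aemeasurable h1

/-! ### The score -/

section Score

variable {𝓧 : Type*} [MeasurableSpace 𝓧] {T p : ℕ} (P : Measure (𝓧 × Fin (T + 1)))
  [IsProbabilityMeasure P] {R : 𝓧 → Fin p → ℝ}

theorem measurable_propensity (t : Fin (T + 1)) : Measurable (propensity P t) :=
  (Kernel.measurable_coe P.condKernel (measurableSet_singleton t)).ennreal_toReal

theorem propensity_nonneg (t : Fin (T + 1)) (x : 𝓧) : 0 ≤ propensity P t x :=
  measureReal_nonneg

theorem sum_propensity (x : 𝓧) : ∑ t, propensity P t x = 1 := by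
  simp only [propensity]
  have := sum_measureReal_singleton (μ := P.condKernel x) (Finset.univ : Finset (Fin (T + 1)))
  rw [this]
  simp

theorem propensity_le_one (t : Fin (T + 1)) (x : 𝓧) : propensity P t x ≤ 1 := by
  rw [← sum_propensity P x]
  exact Finset.single_le_sum (f := fun t => propensity P t x)
    (fun t _ => propensity_nonneg P t x) (Finset.mem_univ t)

/-- A single summand of the score. -/
noncomputable def scoreTerm (R : 𝓧 → Fin p → ℝ) (t : Fin T) (j : Fin p)
    (z : 𝓧 × Fin (T + 1)) : ℝ :=
  R z.1 j * ((if z.2 = t.succ then 1 else 0) - propensity P t.succ z.1)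

theorem measurable_scoreTerm (hR : Measurable R) (t : Fin T) (j : Fin p) :
    Measurable (scoreTerm P R t j) := by
  have h1 : Measurable fun z : 𝓧 × Fin (T + 1) => R z.1 j :=
    (measurable_pi_apply j).comp (hR.comp measurable_fst)
  have h2 : Measurable fun z : 𝓧 × Fin (T + 1) => if z.2 = t.succ then (1 : ℝ) else 0 :=
    Measurable.ite (measurable_snd (measurableSet_singleton t.succ)) measurable_const
      measurable_const
  exact h1.mul (h2.sub ((measurable_propensity P t.succ).comp measurable_fst))

theorem abs_scoreTerm_le {X : ℝ} {z : 𝓧 × Fin (T + 1)} (hz : ∀ j, |R z.1 j| ≤ X)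
    (t : Fin T) (j : Fin p) : |scoreTerm P R t j z| ≤ X := by
  rw [scoreTerm, abs_mul]
  refine (mul_le_of_le_one_right (abs_nonneg _) ?_).trans (hz j)
  have h0 := propensity_nonneg P t.succ z.1
  have h1 := propensity_le_one P t.succ z.1
  rw [abs_le]
  split_ifs <;> constructor <;> linarith

/-- Given X, the treatment indicator has conditional mean equal to the propensity; integrating first
over the conditional kernel gives zero. -/
theorem integral_scoreTerm (hR : Measurable R) {X : ℝ}
    (hX : ∀ᵐ x ∂P.fst, ∀ j, |R x j| ≤ X) (t : Fin T) (j : Fin p) :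
    ∫ z, scoreTerm P R t j z ∂P = 0 := by
  have hint : Integrable (scoreTerm P R t j) P :=
    Integrable.of_bound (measurable_scoreTerm P hR t j).aestronglyMeasurable X
      ((ae_of_ae_fst P hX).mono fun z hz => abs_scoreTerm_le P hz t j)
  rw [← Measure.integral_condKernel hint]
  refine integral_eq_zero_of_ae (Eventually.of_forall fun x => ?_)
  simp only [scoreTerm, Pi.zero_apply]
  rw [integral_const_mul, integral_sub (Integrable.of_finite) (integrable_const _)]
  have : ∫ y, (if y = t.succ then (1 : ℝ) else 0) ∂P.condKernel x = propensity P t.succ x := by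
    have h := integral_indicator_one (μ := P.condKernel x) (measurableSet_singleton t.succ)
    rw [propensity, ← h]
    refine integral_congr_ae (Eventually.of_forall fun y => ?_)
    simp [Set.indicator_apply]
  rw [this]
  simp

variable {Ω : Type*} [MeasurableSpace Ω] (μ : Measure Ω) [IsProbabilityMeasure μ] {n : ℕ}
  {Z : Fin n → Ω → 𝓧 × Fin (T + 1)}

/-- Hoeffding's inequality for independent centered summands in [-X, X], applied to both signs. -/
theorem measure_le_abs_score_le (hR : Measurable R) {X : ℝ} (hX0 : 0 < X)
    (hX : ∀ᵐ x ∂P.fst, ∀ j, |R x j| ≤ X) (hZ : ∀ i, Measurable (Z i))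
    (hlaw : ∀ i, μ.map (Z i) = P) (hindep : iIndepFun Z μ) (hn : 0 < n) {u : ℝ} (hu : 0 ≤ u)
    (t : Fin T) (j : Fin p) :
    μ.real {ω | u ≤ |score (fun i => R (Z i ω).1) (fun i => (Z i ω).2)
        (fun i t => propensity P t.succ (Z i ω).1) t j|}
      ≤ 2 * Real.exp (-(n * u ^ 2 / (2 * X ^ 2))) := by
  have hn' : (0 : ℝ) < n := by exact_mod_cast hn
  set g := scoreTerm P R t j with hg
  have hgm : Measurable g := measurable_scoreTerm P hR t j
  set Y : Fin n → Ω → ℝ := fun i ω => g (Z i ω) with hY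
  have hYind : iIndepFun Y μ := hindep.comp (fun _ => g) fun _ => hgm
  have hYsub : ∀ i, HasSubgaussianMGF (Y i) ((‖X - -X‖₊ / 2) ^ 2) μ := fun i => by
    refine hasSubgaussianMGF_of_mem_Icc_of_integral_eq_zero
      (hgm.comp (hZ i)).aemeasurable ?_ ?_
    · have h1 := ae_of_ae_fst P hX
      rw [← hlaw i] at h1
      filter_upwards [ae_of_ae_map (hZ i).aemeasurable h1] with ω hω
      exact abs_le.mp (abs_scoreTerm_le P hω t j)
    · have h1 := integral_map (μ := μ) (hZ i).aemeasurable (f := g)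
        hgm.aestronglyMeasurable
      rw [hlaw i, hg, integral_scoreTerm P hR hX] at h1
      exact h1.symm
  -- The variance proxy is the squared half-length of [-X, X].
  have hc : (((‖X - -X‖₊ / 2) ^ 2 : NNReal) : ℝ) = X ^ 2 := by
    rw [NNReal.coe_pow, NNReal.coe_div, coe_nnnorm, Real.norm_eq_abs,
      abs_of_nonneg (by linarith)]
    norm_num
  have hexp : ∀ W : Fin n → Ω → ℝ, iIndepFun W μ →
      (∀ i, HasSubgaussianMGF (W i) ((‖X - -X‖₊ / 2) ^ 2) μ) →
      μ.real {ω | n * u ≤ ∑ i, W i ω} ≤ Real.exp (-(n * u ^ 2 / (2 * X ^ 2))) := by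
    intro W hW hWs
    refine (HasSubgaussianMGF.measure_sum_ge_le_of_iIndepFun hW (s := Finset.univ)
      (fun i _ => hWs i) (mul_nonneg hn'.le hu)).trans (le_of_eq ?_)
    congr 1
    rw [NNReal.coe_sum]
    simp only [hc, Finset.sum_const, Finset.card_univ, Fintype.card_fin, nsmul_eq_mul]
    field_simp
  have h1 := hexp Y hYind hYsub
  have h2 := hexp (fun i => -Y i) (hYind.comp (fun _ y => -y) fun _ => measurable_neg)
    fun i => (hYsub i).neg
  refine le_trans (measureReal_mono (s₂ := {ω | n * u ≤ ∑ i, Y i ω}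
    ∪ {ω | n * u ≤ ∑ i, (-Y i) ω}) fun ω hω => ?_)
    ((measureReal_union_le _ _).trans (by linarith))
  have h3 : score (fun i => R (Z i ω).1) (fun i => (Z i ω).2)
      (fun i t => propensity P t.succ (Z i ω).1) t j = (∑ i, Y i ω) / n := rfl
  rw [Set.mem_ofPred_eq, h3, abs_div, Nat.abs_cast, le_div_iff₀ hn', le_abs] at hω
  rcases hω with h | h
  · left; simp only [Set.mem_ofPred_eq]; linarith
  · right; simp only [Set.mem_ofPred_eq, Pi.neg_apply, Finset.sum_neg_distrib]; linarith

theorem measure_exists_le_abs_score_le (hR : Measurable R) {X : ℝ} (hX0 : 0 < X)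
    (hX : ∀ᵐ x ∂P.fst, ∀ j, |R x j| ≤ X) (hZ : ∀ i, Measurable (Z i))
    (hlaw : ∀ i, μ.map (Z i) = P) (hindep : iIndepFun Z μ) (hn : 0 < n) {u : ℝ} (hu : 0 ≤ u) :
    μ.real {ω | ∀ t j, |score (fun i => R (Z i ω).1) (fun i => (Z i ω).2)
        (fun i t => propensity P t.succ (Z i ω).1) t j| ≤ u}ᶜ
      ≤ T * (p * (2 * Real.exp (-(n * u ^ 2 / (2 * X ^ 2))))) := by
  calc _ ≤ μ.real (⋃ t : Fin T, ⋃ j : Fin p, {ω | u ≤ |score (fun i => R (Z i ω).1)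
          (fun i => (Z i ω).2) (fun i t => propensity P t.succ (Z i ω).1) t j|}) := by
        refine measureReal_mono fun ω hω => ?_
        simp only [Set.mem_compl_iff, Set.mem_ofPred_eq, not_forall, not_le] at hω
        obtain ⟨t, j, h⟩ := hω
        exact Set.mem_iUnion.mpr ⟨t, Set.mem_iUnion.mpr ⟨j, h.le⟩⟩
    _ ≤ ∑ _t : Fin T, ∑ _j : Fin p, 2 * Real.exp (-(n * u ^ 2 / (2 * X ^ 2))) :=
        (measureReal_iUnion_fintype_le _).trans (Finset.sum_le_sum fun t _ =>
          (measureReal_iUnion_fintype_le _).trans (Finset.sum_le_sum fun j _ =>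
            measure_le_abs_score_le P μ hR hX0 hX hZ hlaw hindep hn hu t j))
    _ = _ := by simp

end Score

/-! ### The penalty level -/

section Penalty

theorem sq_penalty (xbar δ : ℝ) {T n p : ℕ} :
    penalty xbar δ T n p ^ 2 = 4 * xbar ^ 2 * T / n
      * (1 + Real.log (max p n : ℕ) ^ (3 / 2 + δ) / Real.sqrt T) := by
  have h1 : (0 : ℝ) ≤ Real.log (max p n : ℕ) ^ (3 / 2 + δ) :=
    Real.rpow_nonneg (Real.log_natCast_nonneg _) _
  rw [penalty, mul_pow, Real.sq_sqrt (by positivity), div_pow, mul_pow,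
    Real.sq_sqrt (Nat.cast_nonneg _), Real.sq_sqrt (Nat.cast_nonneg _)]
  ring

theorem penalty_pos {xbar δ : ℝ} (hx : 0 < xbar) {T n p : ℕ} (hT : 1 ≤ T) (hn : 1 ≤ n) :
    0 < penalty xbar δ T n p := by
  have h1 : (0 : ℝ) ≤ Real.log (max p n : ℕ) ^ (3 / 2 + δ) :=
    Real.rpow_nonneg (Real.log_natCast_nonneg _) _
  have hT' : (0 : ℝ) < T := by exact_mod_cast hT
  have hn' : (0 : ℝ) < n := by exact_mod_cast hn
  unfold penalty
  positivity

/-- This turns λs → 0 into s = o(√n). -/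
theorem two_mul_div_sqrt_le_penalty {xbar δ : ℝ} (hx : 0 < xbar) {T n p : ℕ} (hT : 1 ≤ T) :
    2 * xbar / Real.sqrt n ≤ penalty xbar δ T n p := by
  have h1 : (0 : ℝ) ≤ Real.log (max p n : ℕ) ^ (3 / 2 + δ) :=
    Real.rpow_nonneg (Real.log_natCast_nonneg _) _
  have hT' : (1 : ℝ) ≤ T := by exact_mod_cast hT
  have h2 : 1 ≤ Real.sqrt (1 + Real.log (max p n : ℕ) ^ (3 / 2 + δ) / Real.sqrt T) := by
    rw [Real.one_le_sqrt]; 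
    linarith [show 0 ≤ Real.log (max p n : ℕ) ^ (3 / 2 + δ) / Real.sqrt T by positivity]
  have h3 : 1 ≤ Real.sqrt T := Real.one_le_sqrt.mpr hT'
  unfold penalty
  calc 2 * xbar / Real.sqrt n = 2 * xbar * 1 / Real.sqrt n * 1 := by ring
    _ ≤ _ := by gcongr

theorem tendsto_log_max (p : ℕ → ℕ) :
    Tendsto (fun n => Real.log (max (p n) n : ℕ)) atTop atTop :=
  Real.tendsto_log_atTop.comp (tendsto_natCast_atTop_atTop.comp
    (tendsto_atTop_mono (fun n => le_max_right (p n) n) tendsto_id))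

theorem sq_penalty_le {xbar δ : ℝ} (hδ : 0 < δ) {T : ℕ} (hT : 1 ≤ T) (p : ℕ → ℕ) :
    ∀ᶠ n in atTop, penalty xbar δ T n (p n) ^ 2
      ≤ 8 * xbar ^ 2 * T * ((n : ℝ)⁻¹ * Real.log (max (p n) n : ℕ) ^ (3 / 2 + δ)) := by
  have hT' : (1 : ℝ) ≤ T := by exact_mod_cast hT
  filter_upwards [(tendsto_log_max p).eventually_ge_atTop 1] with n hn
  rw [sq_penalty]
  have h1 : 1 ≤ Real.log (max (p n) n : ℕ) ^ (3 / 2 + δ) := Real.one_le_rpow hn (by linarith)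
  have h2 : Real.log (max (p n) n : ℕ) ^ (3 / 2 + δ) / Real.sqrt T
      ≤ Real.log (max (p n) n : ℕ) ^ (3 / 2 + δ) :=
    div_le_self (by linarith) (Real.one_le_sqrt.mpr hT')
  calc _ ≤ 4 * xbar ^ 2 * T / n * (2 * Real.log (max (p n) n : ℕ) ^ (3 / 2 + δ)) := by
        gcongr; linarith
    _ = _ := by ring

/-- The quantity n λ² grows at least like l^(3/2) with l = log(p ∨ n). As 3/2 > 1, any fixed
multiple eventually exceeds 2l, beating p ≤ exp l. Hence any fixed fraction of λ dominates the
score. -/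
theorem tendsto_mul_exp_neg_sq_penalty {xbar δ c : ℝ} (hx : 0 < xbar) (hδ : 0 < δ) (hc : 0 < c)
    {T : ℕ} (hT : 1 ≤ T) (p : ℕ → ℕ) :
    Tendsto (fun n => (p n : ℝ) * Real.exp (-(c * (n * penalty xbar δ T n (p n) ^ 2))))
      atTop (𝓝 0) := by
  have hT' : (0 : ℝ) < T := by exact_mod_cast hT
  set c' := c * (4 * xbar ^ 2 * T) / Real.sqrt T with hc'
  have hc0 : 0 < c' := by positivity
  have hlog := tendsto_log_max p
  have hlim : Tendsto (fun n => Real.exp (-Real.log (max (p n) n : ℕ))) atTop (𝓝 0) :=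
    Real.tendsto_exp_neg_atTop_nhds_zero.comp hlog
  refine tendsto_of_tendsto_of_tendsto_of_le_of_le' tendsto_const_nhds hlim
    (Eventually.of_forall fun n => by positivity) ?_
  have hpow : Tendsto (fun n => Real.log (max (p n) n : ℕ) ^ (1 / 2 : ℝ)) atTop atTop :=
    (tendsto_rpow_atTop (by norm_num)).comp hlog
  filter_upwards [hlog.eventually_ge_atTop 1, hpow.eventually_ge_atTop (2 / c'),
    eventually_ge_atTop 1] with n h1 h2 hn
  have hn' : (0 : ℝ) < n := by exact_mod_cast hn
  set l := Real.log (max (p n) n : ℕ) with hl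
  have hl0 : 0 < l := by linarith
  have h3 : (p n : ℝ) ≤ Real.exp l := by
    rw [hl, Real.exp_log (by exact_mod_cast (lt_of_lt_of_le hn (le_max_right _ _)))]
    exact_mod_cast le_max_left _ _
  have h4 : 2 * l ≤ c * (n * penalty xbar δ T n (p n) ^ 2) := by
    rw [sq_penalty, ← hl]
    have h5 : l ^ (3 / 2 : ℝ) ≤ l ^ (3 / 2 + δ) :=
      Real.rpow_le_rpow_of_exponent_le h1 (by linarith)
    have h6 : l ^ (3 / 2 : ℝ) = l ^ (1 / 2 : ℝ) * l := by
      rw [show (3 / 2 : ℝ) = 1 / 2 + 1 by norm_num, Real.rpow_add hl0, Real.rpow_one]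
    have h7 : 2 ≤ c' * l ^ (1 / 2 : ℝ) := by
      rw [div_le_iff₀ hc0] at h2; linarith
    calc 2 * l ≤ c' * l ^ (1 / 2 : ℝ) * l := by gcongr
      _ = c' * l ^ (3 / 2 : ℝ) := by rw [h6]; ring
      _ ≤ c' * l ^ (3 / 2 + δ) := by gcongr
      _ = c * (4 * xbar ^ 2 * T * (l ^ (3 / 2 + δ) / Real.sqrt T)) := by rw [hc']; ring
      _ ≤ c * (4 * xbar ^ 2 * T * (1 + l ^ (3 / 2 + δ) / Real.sqrt T)) := by
          gcongr; linarith
      _ = _ := by field_simp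
  calc _ ≤ Real.exp l * Real.exp (-(2 * l)) := by gcongr
    _ = Real.exp (-l) := by rw [← Real.exp_add]; congr 1; ring

end Penalty

/-- The score is of smaller order than the penalty level. -/
theorem wpa1_score_le {T : ℕ} (hT : 1 ≤ T) (p : ℕ → ℕ) {xbar δ : ℝ} (hxbar : 0 < xbar)
    (hδ : 0 < δ) {𝓧 : ℕ → Type*} [∀ n, MeasurableSpace (𝓧 n)]
    (P : ∀ n, Measure (𝓧 n × Fin (T + 1))) [∀ n, IsProbabilityMeasure (P n)]
    (R : ∀ n, 𝓧 n → Fin (p n) → ℝ) (hR : ∀ n, Measurable (R n))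
    (hbounded : ∀ n, ∀ᵐ x ∂(P n).fst, ∀ j, |R n x j| ≤ xbar)
    {Ω : ℕ → Type*} [∀ n, MeasurableSpace (Ω n)]
    (μ : ∀ n, Measure (Ω n)) [∀ n, IsProbabilityMeasure (μ n)]
    (Z : ∀ n, Fin n → Ω n → 𝓧 n × Fin (T + 1)) (hZ : ∀ n i, Measurable (Z n i))
    (hlaw : ∀ n i, (μ n).map (Z n i) = P n) (hindep : ∀ n, iIndepFun (Z n) (μ n)) {c : ℝ}
    (hc : 0 < c) :
    WPA1 μ fun n => {ω | ∀ t j, |score (fun i => R n (Z n i ω).1) (fun i => (Z n i ω).2)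
      (fun i t => propensity (P n) t.succ (Z n i ω).1) t j|
        ≤ c * penalty xbar δ T n (p n)} := by
  have h1 := (tendsto_mul_exp_neg_sq_penalty (c := c ^ 2 / (2 * xbar ^ 2)) hxbar hδ
    (by positivity) hT p).const_mul (2 * T : ℝ)
  rw [mul_zero] at h1
  have h2 := ENNReal.tendsto_ofReal h1
  rw [ENNReal.ofReal_zero] at h2
  refine tendsto_of_tendsto_of_tendsto_of_le_of_le' tendsto_const_nhds h2
    (Eventually.of_forall fun _ => zero_le) ?_
  filter_upwards [eventually_ge_atTop 1] with n hn
  have hpen := (penalty_pos (δ := δ) (p := p n) hxbar hT hn).le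
  have h3 := measure_exists_le_abs_score_le (P n) (μ n) (hR n) hxbar (hbounded n) (hZ n)
    (hlaw n) (hindep n) hn (mul_nonneg hc.le hpen)
  refine (ENNReal.le_ofReal_iff_toReal_le (measure_ne_top _ _)
    (by positivity)).mpr (h3.trans (le_of_eq ?_))
  have h4 : (n : ℝ) * (c * penalty xbar δ T n (p n)) ^ 2 / (2 * xbar ^ 2)
      = c ^ 2 / (2 * xbar ^ 2) * (n * penalty xbar δ T n (p n) ^ 2) := by ring
  rw [h4]; ring

/-! ### Finite-sample bounds with uniform constants -/

/-- The sample has bounded covariates, overlap, a score dominated by the penalty level, and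
approximation bias at most `b`. -/
structure RegularSample (X pmin : ℝ) {n T p : ℕ} (x : Fin n → Fin p → ℝ)
    (d : Fin n → Fin (T + 1)) (π : Fin n → Fin T → ℝ) (γ : Fin T → Fin p → ℝ)
    (lam b : ℝ) : Prop where
  bounded : ∀ i j, |x i j| ≤ X
  overlap : ∀ i t, pmin ≤ π i t
  overlap_baseline : ∀ i, pmin ≤ 1 - ∑ t, π i t
  score_le : ∀ t j, |score x d π t j| ≤ lam / (8 * T)
  bias_nonneg : 0 ≤ b
  bias_le : ∀ t, fitMSE x π γ t ≤ b ^ 2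

section FiniteSample

variable {T : ℕ} {X pmin : ℝ}

/-- The bias assumption makes the lasso MSE of order λ² s, so the factor λ² cancels in
`card_mul_sq_le`. -/
theorem exists_card_suppUnion_lasso_le (hT : 1 ≤ T) (hX0 : 0 ≤ X) (hpmin : 0 < pmin)
    {κ₀ Cb φ : ℝ} (hκ₀ : 0 < κ₀) (hCb : 0 ≤ Cb) :
    ∃ η K : ℝ, 0 < η ∧ 0 < K ∧ ∀ {n p : ℕ} {x : Fin n → Fin p → ℝ} {d : Fin n → Fin (T + 1)}
      {π : Fin n → Fin T → ℝ} {γ γtilde : Fin T → Fin p → ℝ} {lam b κ : ℝ} {s : ℕ},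
      RegularSample X pmin x d π γ lam b → (suppUnion γ).card = s → 0 < lam →
      IsGroupLasso x d lam γtilde → κ₀ ≤ κ →
      IsRestrictedEigenvalue T (gram x) (suppUnion γ) κ → b ≤ Cb * (lam * Real.sqrt s) →
      lam * s + b * Real.sqrt s ≤ η → sparseEigMaxCard (gram x) n ≤ φ → K * s < n →
      ((suppUnion γtilde).card : ℝ) ≤ K * s := by
  have hT0 : (0 : ℝ) ≤ T := Nat.cast_nonneg _
  set K₁ := 5 / κ₀ + 3 * T * Cb with hK₁
  have hK₁0 : 0 ≤ K₁ := by positivity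
  -- Penalty and score together cost at most (9/8) λ times the mixed norm, hence at most 2 K₁ λ r q;
  -- the bias costs T b q. No term free of q remains, so A = 0.
  obtain ⟨η, C, hη, hC, hfit⟩ := exists_fitNorm_le T (K := T * K₁) (A := 0) (B := 2 * K₁ + T)
    hX0 hpmin (by positivity) le_rfl (by positivity)
  set V := 2 * Cb ^ 2 + 8 * (C * (1 + Cb)) ^ 2 with hV
  have hV0 : 0 ≤ V := by positivity
  -- The summand 1 only ensures that K is positive.
  set K := 4 * T * φ ^ 2 * (T * V) + 1 with hK
  have hK0 : 0 < K := by positivity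
  refine ⟨η, K, hη, hK0, ?_⟩
  intro n p x d π γ γtilde lam b κ s hreg hs hlam hlasso hκ hre hb hsmall hφ hKn
  obtain ⟨δ, rfl⟩ : ∃ δ, γtilde = γ + δ := ⟨γtilde - γ, by simp⟩
  obtain ⟨hX, hπ, hπ0, hσ, hb0, hbias⟩ := hreg
  set r := Real.sqrt s with hr
  have hr0 : 0 ≤ r := Real.sqrt_nonneg _
  have hrs : r * r = s := Real.mul_self_sqrt (Nat.cast_nonneg _)
  have hq := fitNorm_nonneg x δ
  have hmix := mixedNormOn_lasso_le hT hlam hlasso hσ hb0 hbias hκ₀ hκ hre hCb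
    (by rw [hs]; exact hb)
  rw [hs, ← hK₁, ← hr] at hmix
  have hscore := score_term_le hT hlam.le δ
  have habs := absSum_le_mul_mixedNormOn δ
  have hsplit := mixedNormOn_add_compl (suppUnion γ) δ
  have hc := mixedNormOn_nonneg (suppUnion γ)ᶜ δ
  set m := mixedNormOn Finset.univ δ
  set q := fitNorm x δ
  have hm0 : 0 ≤ m := mixedNormOn_nonneg _ _
  have hqe : q ≤ C * (lam * r + b) := by
    refine hfit hX hπ hπ0 hσ hb0 hbias hr0 ?_ (mlogitLoss_lasso_le hlam.le hlasso)
      (by nlinarith) ?_ ?_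
    · calc _ ≤ T * m := habs
        _ ≤ T * (K₁ * r * q) := by gcongr
        _ = _ := by ring
    · have h1 : lam * (mixedNormOn (suppUnion γ) δ - mixedNormOn (suppUnion γ)ᶜ δ) ≤ lam * m := by
        gcongr; linarith
      have h2 : lam * m ≤ lam * (K₁ * r * q) := by gcongr
      have h3 : 0 ≤ T * (lam * r) * q := by positivity
      have h4 : 0 ≤ K₁ * b * q := by positivity
      have h5 : 0 ≤ lam * (K₁ * r * q) := by positivity
      nlinarith
    · calc r * (lam * r + b) = lam * (r * r) + b * r := by ring
        _ ≤ η := by rw [hrs]; exact hsmall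
  have hmse : ∀ t, fitMSE x π (γ + δ) t ≤ V * (lam ^ 2 * s) := fun t => by
    have h1 := fitMSE_add_le x π γ δ t
    have h2 : q ≤ C * (1 + Cb) * (lam * r) := by
      calc q ≤ C * (lam * r + b) := hqe
        _ ≤ C * (lam * r + Cb * (lam * r)) := by gcongr
        _ = _ := by ring
    have h3 := pow_le_pow_left₀ hq h2 2
    have h4 := pow_le_pow_left₀ hb0 hb 2
    have h5 : (lam * r) ^ 2 = lam ^ 2 * s := by rw [mul_pow, ← hrs]; ring
    rw [mul_pow, h5] at h3 h4
    rw [hV, add_mul]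
    linarith [hbias t]
  have hcard : ∀ A ⊆ suppUnion (γ + δ), A.card ≤ n → (A.card : ℝ) ≤ K * s := fun A hA hAn => by
    have h1 := card_mul_sq_le hT hlam hX0 hX hlasso hσ hA
      ((sparseEigMax_le_sparseEigMaxCard hX0 hX hAn).trans hφ)
    have h2 : ∑ t, fitMSE x π (γ + δ) t ≤ T * (V * (lam ^ 2 * s)) := by
      calc _ ≤ ∑ _t : Fin T, V * (lam ^ 2 * s) := Finset.sum_le_sum fun t _ => hmse t
        _ = _ := by simp
    refine le_of_mul_le_mul_right ?_ (pow_pos hlam 2)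
    calc _ ≤ _ := h1
      _ ≤ 4 * T * φ ^ 2 * (T * (V * (lam ^ 2 * s))) := by gcongr
      _ ≤ 4 * T * φ ^ 2 * (T * (V * (lam ^ 2 * s))) + s * lam ^ 2 :=
          le_add_of_nonneg_right (by positivity)
      _ = _ := by rw [hK]; ring
  -- The eigenvalue bound reaches only sets of size n. A larger support contains a subset of size
  -- exactly n, for which the count would give n ≤ K s.
  rcases le_or_gt (suppUnion (γ + δ)).card n with hle | hgt
  · exact hcard _ (Finset.Subset.refl _) hle
  · obtain ⟨A, hA, hAn⟩ := Finset.exists_subset_card_eq hgt.le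
    have := hcard A hA hAn.le
    rw [hAn] at this
    exact absurd this (not_le.mpr hKn)

/-- Both estimates differ from γ only on the union of `Shat` and the support of γ. Sparse
eigenvalues there replace the restricted eigenvalue, so b need not be O(λ√s). -/
theorem exists_refit_error_le (hT : 1 ≤ T) (hX0 : 0 ≤ X) (hpmin : 0 < pmin)
    {M c : ℝ} (hM : 0 ≤ M) (hc : 0 < c) :
    ∃ η C : ℝ, 0 < η ∧ 0 < C ∧ ∀ {n p : ℕ} {x : Fin n → Fin p → ℝ} {d : Fin n → Fin (T + 1)}
      {π : Fin n → Fin T → ℝ} {γ γtilde γhat : Fin T → Fin p → ℝ} {lam b : ℝ} {s : ℕ}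
      {Shat : Finset (Fin p)},
      RegularSample X pmin x d π γ lam b → (suppUnion γ).card = s → 0 ≤ lam →
      IsGroupLasso x d lam γtilde → suppUnion γtilde ⊆ Shat → IsRefit x d Shat γhat →
      (Shat.card : ℝ) ≤ M * s →
      (∀ S : Finset (Fin p), S.Nonempty → (S.card : ℝ) ≤ (M + 1) * s →
        c ≤ sparseEigMin (gram x) S) →
      lam * s + b * Real.sqrt s ≤ η →
      (∀ t, fitMSE x π γhat t ≤ C * (lam ^ 2 * s + b ^ 2)) ∧
        absSum (γhat - γ) ≤ C * (lam * s + b * Real.sqrt s) := by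
  have hT0 : (0 : ℝ) ≤ T := Nat.cast_nonneg _
  have hT1 : (1 : ℝ) ≤ T := by exact_mod_cast hT
  set K := T * (Real.sqrt (M + 1) / c) with hK
  have hK0 : 0 ≤ K := by positivity
  obtain ⟨η₁, C₁, hη₁, hC₁, hfit₁⟩ := exists_fitNorm_le T (K := K) (A := 0) (B := 2 * K + T)
    hX0 hpmin hK0 le_rfl (by positivity)
  -- The constant A = K C₁ pays for the excess loss of the lasso over γ, which bounds that of the
  -- refit.
  obtain ⟨η₂, C₂, hη₂, hC₂, hfit₂⟩ := exists_fitNorm_le T (K := K) (A := K * C₁) (B := K + T)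
    hX0 hpmin hK0 (by positivity) (by positivity)
  refine ⟨min η₁ η₂, 2 + 16 * C₂ ^ 2 + K * C₂, lt_min hη₁ hη₂, by positivity, ?_⟩
  intro n p x d π γ γtilde γhat lam b s Shat hreg hs hlam hlasso hsub hrefit hcard heig hsmall
  obtain ⟨δ, rfl⟩ : ∃ δ, γtilde = γ + δ := ⟨γtilde - γ, by simp⟩
  obtain ⟨δ', rfl⟩ : ∃ δ', γhat = γ + δ' := ⟨γhat - γ, by simp⟩
  obtain ⟨hX, hπ, hπ0, hσ, hb0, hbias⟩ := hreg
  set r := Real.sqrt s with hr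
  have hr0 : 0 ≤ r := Real.sqrt_nonneg _
  have hrs : r * r = s := Real.mul_self_sqrt (Nat.cast_nonneg _)
  set e := lam * r + b with he
  have hlr : 0 ≤ lam * r := mul_nonneg hlam hr0
  have he0 : 0 ≤ e := by positivity
  have hre : r * e ≤ min η₁ η₂ := by
    calc r * (lam * r + b) = lam * (r * r) + b * r := by ring
      _ ≤ _ := by rw [hrs]; exact hsmall
  have hScard : ((Shat ∪ suppUnion γ).card : ℝ) ≤ (M + 1) * s := by
    have : ((Shat ∪ suppUnion γ).card : ℝ) ≤ Shat.card + (suppUnion γ).card := by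
      exact_mod_cast Finset.card_union_le _ _
    rw [hs] at this; linarith
  have habs : ∀ ζ : Fin T → Fin p → ℝ, suppUnion (γ + ζ) ⊆ Shat →
      absSum ζ ≤ K * r * fitNorm x ζ := fun ζ hζ => by
    have h1 := absSum_le_fitNorm hc hScard (fun hne => heig _ hne hScard) (δ := ζ)
      fun t j hj => by
        rw [Finset.mem_union, not_or] at hj
        have h2 := eq_zero_of_notMem_suppUnion (fun h => hj.1 (hζ h)) t
        rwa [Pi.add_apply, Pi.add_apply, eq_zero_of_notMem_suppUnion hj.2, zero_add] at h2
    rwa [Real.sqrt_mul (by linarith), ← hr,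
      show T * (Real.sqrt (M + 1) * r / c) = K * r by rw [hK]; ring] at h1
  have hσlam : lam / (8 * T) ≤ lam := div_le_self hlam (by linarith)
  have hmain := habs δ hsub
  have hmain' := habs δ' hrefit.1
  have hq := fitNorm_nonneg x δ
  have hq' := fitNorm_nonneg x δ'
  have hbe : b ≤ e := by linarith
  have hstep : ∀ ζ : Fin T → Fin p → ℝ, suppUnion (γ + ζ) ⊆ Shat →
      lam * absSum ζ ≤ K * e * fitNorm x ζ := fun ζ hζ => by
    have hqz := fitNorm_nonneg x ζ
    calc _ ≤ lam * (K * r * fitNorm x ζ) := by gcongr; exact habs ζ hζ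
      _ = K * (lam * r) * fitNorm x ζ := by ring
      _ ≤ _ := by gcongr; linarith
  have hbstep : ∀ ζ : Fin T → Fin p → ℝ, T * b * fitNorm x ζ ≤ T * e * fitNorm x ζ :=
    fun ζ => by have := fitNorm_nonneg x ζ; gcongr
  have hloss : mlogitLoss x d (γ + δ) ≤ mlogitLoss x d γ + lam * absSum δ := by
    refine (mlogitLoss_lasso_le hlam hlasso).trans ?_
    have h1 := mixedNormOn_univ_le_absSum δ
    rw [← mixedNormOn_add_compl (suppUnion γ)] at h1
    gcongr
    linarith [mixedNormOn_nonneg (suppUnion γ)ᶜ δ]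
  have hqe : fitNorm x δ ≤ C₁ * e := by
    refine hfit₁ hX hπ hπ0 hσ hb0 hbias hr0 hmain hloss hbe ?_ (hre.trans (min_le_left _ _))
    have h1 := mul_le_mul_of_nonneg_right hσlam (absSum_nonneg δ)
    linarith [hstep δ hsub, hbstep δ]
  have hloss' : mlogitLoss x d (γ + δ') ≤ mlogitLoss x d γ + K * C₁ * e ^ 2 := by
    have h1 := hrefit.2 _ hsub
    have h2 : K * e * fitNorm x δ ≤ K * e * (C₁ * e) := by gcongr
    have h3 := hstep δ hsub
    linarith
  have hqe' : fitNorm x δ' ≤ C₂ * e := by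
    refine hfit₂ hX hπ hπ0 hσ hb0 hbias hr0 hmain' hloss' hbe ?_ (hre.trans (min_le_right _ _))
    have h1 := mul_le_mul_of_nonneg_right hσlam (absSum_nonneg δ')
    linarith [hstep δ' hrefit.1, hbstep δ']
  refine ⟨fun t => ?_, ?_⟩
  · have h1 := fitMSE_add_le x π γ δ' t
    have h2 := pow_le_pow_left₀ hq' hqe' 2
    have h3 : e ^ 2 ≤ 2 * (lam ^ 2 * s + b ^ 2) := by
      rw [← hrs, he]; nlinarith [sq_nonneg (lam * r - b)]
    have h4 : (C₂ * e) ^ 2 ≤ C₂ ^ 2 * (2 * (lam ^ 2 * s + b ^ 2)) := by rw [mul_pow]; gcongr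
    have h5 : 0 ≤ lam ^ 2 * s := by positivity
    have h6 : 0 ≤ K * C₂ * (lam ^ 2 * s + b ^ 2) := by positivity
    have h7 := hbias t
    rw [add_mul, add_mul]
    linarith
  · rw [add_sub_cancel_left]
    calc absSum δ' ≤ K * r * (C₂ * e) := hmain'.trans (by gcongr)
      _ = K * C₂ * (lam * (r * r) + b * r) := by rw [he]; ring
      _ = K * C₂ * (lam * s + b * r) := by rw [hrs]
      _ ≤ _ := by
          have : 0 ≤ lam * s + b * r := by positivity
          have h2 : 0 ≤ (2 + 16 * C₂ ^ 2) * (lam * s + b * r) := by positivity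
          linarith

theorem sparsityFactor_le {AK κ κ₀ lam b Cb : ℝ} {s : ℕ} (hpmin : 0 < pmin) (hAK : 0 ≤ AK)
    (hκ₀ : 0 < κ₀) (hκ : κ₀ ≤ κ) (hlam : 0 < lam) (hb0 : 0 ≤ b) (hbp : b ≤ pmin / 2)
    (hCb : 0 ≤ Cb) (hb : b ≤ Cb * (lam * Real.sqrt s)) :
    sparsityFactor T pmin AK κ lam b s
      ≤ T * ((2 / pmin) ^ (T + 1) * T * AK * (6 / κ₀ + 8 * Cb * Real.sqrt T) + Cb) ^ 2 := by
  set l := lam * Real.sqrt s with hl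
  have hl0 : 0 ≤ l := by positivity
  have hκ' : 0 < κ := hκ₀.trans_le hκ
  have hmax : max 0 (pmin - b) = pmin - b := max_eq_right (by linarith)
  have hfac : pmin / max 0 (pmin - b) / pmin ≤ 2 / pmin := by
    rw [hmax, div_right_comm, div_self hpmin.ne', div_le_div_iff₀ (by linarith) hpmin]
    linarith
  have hfac0 : 0 ≤ pmin / max 0 (pmin - b) / pmin := by positivity
  have hR : errorBound T pmin AK κ lam b s
      ≤ (2 / pmin) ^ (T + 1) * T * AK * (6 / κ₀ + 8 * Cb * Real.sqrt T) * l := by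
    rw [errorBound, ← hl]
    calc _ ≤ (2 / pmin) ^ (T + 1) * T * AK
          * (6 * (l / κ₀) + 8 * (Cb * l) * Real.sqrt T) := by gcongr
      _ = _ := by ring
  have hR0 : 0 ≤ errorBound T pmin AK κ lam b s := by
    rw [errorBound]; positivity
  rw [sparsityFactor, ← hl]
  gcongr
  -- This form also covers s = 0, where the quotient by λ√s is zero by convention.
  refine div_le_of_le_mul₀ hl0 (by positivity) ?_
  rw [add_mul]; exact add_le_add hR hb

end FiniteSample

end GroupLassoMLogit

/-! ### Assembly along the sequence of laws. -/

open GroupLassoMLogit in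
theorem mainTheorem11
    -- number of nonbaseline treatments, covariate dimension, overlap and support bounds,
    -- exponent in the penalty
    (T : ℕ) (hT : 1 ≤ T) (p : ℕ → ℕ)
    (pmin xbar δ : ℝ) (hpmin : 0 < pmin) (hxbar : 0 < xbar) (hδ : 0 < δ)
    -- the laws `P n` of `(X, D)` and the transformations `X* = R n X`
    {𝓧 : ℕ → Type*} [∀ n, MeasurableSpace (𝓧 n)]
    (P : ∀ n, Measure (𝓧 n × Fin (T + 1))) [∀ n, IsProbabilityMeasure (P n)]
    (R : ∀ n, 𝓧 n → Fin (p n) → ℝ) (hR : ∀ n, Measurable (R n))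
    -- overlap and bounded covariates
    (hoverlap : ∀ n, ∀ᵐ x ∂(P n).fst, ∀ t, pmin ≤ propensity (P n) t x)
    (hbounded : ∀ n, ∀ᵐ x ∂(P n).fst, ∀ j, |R n x j| ≤ xbar)
    -- i.i.d. samples of size `n` from `P n`
    {Ω : ℕ → Type*} [∀ n, MeasurableSpace (Ω n)]
    (μ : ∀ n, Measure (Ω n)) [∀ n, IsProbabilityMeasure (μ n)]
    (Z : ∀ n, Fin n → Ω n → 𝓧 n × Fin (T + 1))
    (hZ : ∀ n i, Measurable (Z n i))
    (hlaw : ∀ n i, (μ n).map (Z n i) = P n)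
    (hindep : ∀ n, iIndepFun (Z n) (μ n))
    -- sparse approximation: coefficients `γstar n`, sparsity `s n`, bias bound `b n`
    (γstar : ∀ n, Fin T → Fin (p n) → ℝ) (s : ℕ → ℕ)
    (hs : ∀ n, (suppUnion (γstar n)).card = s n)
    (b : ℕ → ℝ)
    (hbias : WPA1 μ fun n =>
      {ω | ∀ t, Real.sqrt (propensityMSE (P n) (R n) (fun i => Z n i ω) (γstar n) t) ≤ b n})
    -- the penalty level, and `λ s = o(1)`, `b √s = o(1)`
    (lam : ℕ → ℝ) (hlam : ∀ n, lam n = penalty xbar δ T n (p n))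
    (hlams : Tendsto (fun n => lam n * s n) atTop (𝓝 0))
    (hbs : Tendsto (fun n => b n * Real.sqrt (s n)) atTop (𝓝 0))
    -- the covariates of the sample and the empirical Gram matrix
    (x : ∀ n, Ω n → Fin n → Fin (p n) → ℝ) (hx : ∀ n ω i, x n ω i = R n (Z n i ω).1)
    (Q : ∀ n, Ω n → Matrix (Fin (p n)) (Fin (p n)) ℝ) (hQ : ∀ n ω, Q n ω = gram (x n ω))
    -- restricted eigenvalue bounded away from zero
    (κ : ℕ → ℝ) (hκpos : ∃ c : ℝ, 0 < c ∧ ∀ᶠ n in atTop, c ≤ κ n)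
    (hκ : WPA1 μ fun n =>
      {ω | IsRestrictedEigenvalue T (Q n ω) (suppUnion (γstar n)) (κ n)})
    -- minimal sparse eigenvalues over sets of size `O(s)` bounded away from zero
    (hmin : ∀ C : ℝ, 0 < C → ∃ c : ℝ, 0 < c ∧ WPA1 μ fun n =>
      {ω | ∀ S : Finset (Fin (p n)), S.Nonempty → (S.card : ℝ) ≤ C * s n →
        c ≤ sparseEigMin (Q n ω) S})
    -- maximal sparse eigenvalues bounded, uniformly over the index set
    (AK : ℝ) (hAK : 2 < AK)
    (hmax : ∃ C : ℝ, WPA1 μ fun n =>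
      {ω | ∀ m ∈ sparsityIndexSet n T (Q n ω) pmin AK (κ n) (lam n) (b n) (s n),
        sparseEigMaxCard (Q n ω) m ≤ C})
    -- the group lasso estimate
    (γtilde : ∀ n, Ω n → Fin T → Fin (p n) → ℝ)
    (hγtilde : ∀ n ω,
      IsGroupLasso (x n ω) (fun i => (Z n i ω).2) (lam n) (γtilde n ω)) :
    -- number of selected covariates
    ((b =O[atTop] fun n => lam n * Real.sqrt (s n)) →
      IsOP μ (fun n ω => ((suppUnion (γtilde n ω)).card : ℝ)) (fun n => (s n : ℝ))) ∧
    -- for each choice of the refitting set and each refit on it: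
    (∀ (Shat : ∀ n, Ω n → Finset (Fin (p n))) (γhat : ∀ n, Ω n → Fin T → Fin (p n) → ℝ),
      (WPA1 μ fun n => {ω | suppUnion (γtilde n ω) ⊆ Shat n ω ∧
        IsRefit (x n ω) (fun i => (Z n i ω).2) (Shat n ω) (γhat n ω)}) →
      (IsOP μ (fun n ω => ((Shat n ω).card : ℝ)) (fun n => (s n : ℝ)) ∨
        ((b =O[atTop] fun n => lam n * Real.sqrt (s n)) ∧
          IsOP μ (fun n ω => ((Shat n ω \ suppUnion (γtilde n ω)).card : ℝ))
            (fun n => (s n : ℝ)))) →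
      ∀ t : Fin T,
        -- post-selection propensity error
        IsOP μ (fun n ω => propensityMSE (P n) (R n) (fun i => Z n i ω) (γhat n ω) t)
          (fun n => (n : ℝ)⁻¹ * s n * Real.log (max (p n) n : ℕ) ^ (3 / 2 + δ) + b n ^ 2) ∧
        -- `ℓ₁` error of the coefficients
        IsOP μ (fun n ω => ∑ j, |γhat n ω t j - γstar n t j|)
          (fun n =>
            Real.sqrt ((n : ℝ)⁻¹ * (s n : ℝ) ^ 2 * Real.log (max (p n) n : ℕ) ^ (3 / 2 + δ))
              + b n * Real.sqrt (s n))) := by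
  obtain rfl : x = fun n ω i => R n (Z n i ω).1 :=
    funext fun n => funext fun ω => funext fun i => hx n ω i
  obtain rfl : Q = fun n ω => gram fun i => R n (Z n i ω).1 :=
    funext fun n => funext fun ω => hQ n ω
  obtain rfl : lam = fun n => penalty xbar δ T n (p n) := funext hlam
  set π : ∀ n, Ω n → Fin n → Fin T → ℝ :=
    fun n ω i t => propensity (P n) t.succ (Z n i ω).1 with hπ
  have hT0 : (0 : ℝ) < T := by exact_mod_cast hT
  have hlampos : ∀ᶠ n in atTop, 0 < penalty xbar δ T n (p n) := by
    filter_upwards [eventually_ge_atTop 1] with n hn using penalty_pos hxbar hT hn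
  -- An event of probability near one is nonempty, and any point of it bounds b from below by a
  -- square root; T ≥ 1 supplies a treatment.
  have hb0 : ∀ᶠ n in atTop, 0 ≤ b n := by
    filter_upwards [hbias.eventually_nonempty] with n ⟨ω, hω⟩
    exact (Real.sqrt_nonneg _).trans (hω ⟨0, hT⟩)
  have hreg : WPA1 μ fun n => {ω | RegularSample xbar pmin (fun i => R n (Z n i ω).1)
      (fun i => (Z n i ω).2) (π n ω) (γstar n) (penalty xbar δ T n (p n)) (b n)} := by
    have hae : WPA1 μ fun n => {ω | ∀ i, (∀ j, |R n (Z n i ω).1 j| ≤ xbar) ∧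
        ∀ t, pmin ≤ propensity (P n) t (Z n i ω).1} := by
      refine wpa1_of_ae fun n => ?_
      refine ae_all_iff.mpr fun i => ?_
      exact ae_comp_fst_of_map_eq (hZ n i) (hlaw n i) ((hbounded n).and (hoverlap n))
    -- The fraction 1/(8T) compensates for the factor T between the ℓ₁ and mixed norms, leaving λ/8.
    have hsc := wpa1_score_le hT p hxbar hδ P R hR hbounded μ Z hZ hlaw hindep
      (c := 1 / (8 * T)) (by positivity)
    refine ((hae.inter hsc).inter hbias).mono ?_
    filter_upwards [hb0] with n hbn
    rintro ω ⟨⟨h1, h2⟩, h3⟩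
    refine ⟨fun i => (h1 i).1, fun i t => (h1 i).2 _, fun i => ?_, fun t j => ?_, hbn,
      fun t => ?_⟩
    · have h4 := sum_propensity (P n) (Z n i ω).1
      rw [Fin.sum_univ_succ] at h4
      have h5 := (h1 i).2 0
      simp only [hπ]
      linarith
    · refine (h2 t j).trans (le_of_eq ?_)
      ring
    · exact (Real.sqrt_le_left hbn).mp (h3 t)
  have hrate : Tendsto (fun n => penalty xbar δ T n (p n) * s n + b n * Real.sqrt (s n))
      atTop (𝓝 0) := by simpa using hlams.add hbs
  have hsqrt : ∀ c : ℝ, 0 ≤ c → ∀ᶠ n : ℕ in atTop, c * s n < Real.sqrt n := by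
    intro c hc
    have h1 := hlams.const_mul (c / (2 * xbar))
    rw [mul_zero] at h1
    filter_upwards [h1.eventually (gt_mem_nhds zero_lt_one), eventually_ge_atTop 1] with n h2 hn
    have hn' : 0 < Real.sqrt n := Real.sqrt_pos.mpr (by exact_mod_cast hn)
    have h3 := two_mul_div_sqrt_le_penalty (δ := δ) (n := n) (p := p n) hxbar hT
    have h4 : c * s n / Real.sqrt n < 1 := by
      calc c * s n / Real.sqrt n
          = c / (2 * xbar) * (2 * xbar / Real.sqrt n * s n) := by field_simp
        _ ≤ c / (2 * xbar) * (penalty xbar δ T n (p n) * s n) := by gcongr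
        _ < 1 := h2
    rwa [div_lt_one hn'] at h4
  have part1 : (b =O[atTop] fun n => penalty xbar δ T n (p n) * Real.sqrt (s n)) →
      IsOP μ (fun n ω => ((suppUnion (γtilde n ω)).card : ℝ)) (fun n => (s n : ℝ)) := by
    intro hbO
    obtain ⟨Cb, hCb, hbO⟩ := hbO.exists_pos
    rw [isBigOWith_iff] at hbO
    obtain ⟨κ₀, hκ₀, hκ₀n⟩ := hκpos
    obtain ⟨φ, hφ⟩ := hmax
    obtain ⟨η, K, hη, hK, hcard⟩ := exists_card_suppUnion_lasso_le (φ := φ) hT hxbar.le hpmin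
      hκ₀ hCb.le
    refine isOP_of_wpa1 hK (((hreg.inter hκ).inter hφ).mono ?_)
    set Lbar := T * ((2 / pmin) ^ (T + 1) * T * AK * (6 / κ₀ + 8 * Cb * Real.sqrt T) + Cb) ^ 2
      with hLbar
    have hLbar0 : 0 ≤ Lbar := by positivity
    filter_upwards [hbO, hκ₀n, hlampos, hrate.eventually (gt_mem_nhds hη), hsqrt K hK.le,
      hsqrt (8 * Lbar * xbar) (by positivity), hb0,
      hbs.eventually (gt_mem_nhds (half_pos hpmin)), eventually_ge_atTop 1]
      with n hbn hκn hlamn hηn hKn hLn hbn0 hbpn hn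
    rintro ω ⟨⟨hregω, hκω⟩, hφω⟩
    have hn' : (1 : ℝ) ≤ n := by exact_mod_cast hn
    rw [Real.norm_of_nonneg hbn0, Real.norm_of_nonneg (by positivity)] at hbn
    -- If s = 0, then b = O(λ√s) forces b = 0; otherwise b ≤ b√s, which tends to zero.
    have hbp : b n ≤ pmin / 2 := by
      rcases Nat.eq_zero_or_pos (s n) with h0 | h0
      · rw [h0] at hbn
        simp only [Nat.cast_zero, Real.sqrt_zero, mul_zero] at hbn
        linarith
      · have h1 : 1 ≤ Real.sqrt (s n) := Real.one_le_sqrt.mpr (by exact_mod_cast h0)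
        nlinarith
    have hL := sparsityFactor_le (T := T) (AK := AK) hpmin (by linarith) hκ₀ hκn hlamn hbn0 hbp
      hCb.le hbn
    have hsq : Real.sqrt n * Real.sqrt n = n := Real.mul_self_sqrt (Nat.cast_nonneg _)
    -- With L bounded and φ ≤ X√n, the threshold is O(s√n), which is o(n).
    have hmem : n ∈ sparsityIndexSet n T (gram fun i => R n (Z n i ω).1) pmin AK (κ n)
        (penalty xbar δ T n (p n)) (b n) (s n) := by
      refine ⟨hn, le_rfl, ?_⟩
      have h1 := sparseEigMaxCard_le hxbar.le hregω.bounded n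
      have h2 : 0 ≤ sparseEigMaxCard (gram fun i => R n (Z n i ω).1) n :=
        Real.sSup_nonneg (by rintro r ⟨S, _, rfl⟩; exact Real.sqrt_nonneg _)
      calc _ ≤ 8 * s n * Lbar * (xbar * Real.sqrt n) := by gcongr
        _ = 8 * Lbar * xbar * s n * Real.sqrt n := by ring
        _ < Real.sqrt n * Real.sqrt n :=
            mul_lt_mul_of_pos_right hLn (Real.sqrt_pos.mpr (by linarith))
        _ = n := hsq
    have hKn' : K * s n < n := by
      refine hKn.trans_le ?_
      rw [Real.sqrt_le_left (by linarith)]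
      nlinarith
    change |((suppUnion (γtilde n ω)).card : ℝ)| ≤ K * s n
    rw [Nat.abs_cast]
    exact hcard hregω (hs n) hlamn (hγtilde n ω) hκn hκω hbn hηn.le (hφω n hmem) hKn'
  refine ⟨part1, ?_⟩
  intro Shat γhat hsel hcardS t
  have hShat : IsOP μ (fun n ω => ((Shat n ω).card : ℝ)) (fun n => (s n : ℝ)) := by
    rcases hcardS with h | ⟨hbO, h⟩
    · exact h
    · refine h.of_abs_le_add (part1 hbO) fun n ω => ?_
      simp only [Nat.abs_cast]
      exact_mod_cast Finset.card_le_card_sdiff_add_card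
  have hpen := sq_penalty_le (xbar := xbar) hδ hT p
  have key : ∀ M : ℝ, 0 < M → ∃ C : ℝ, 0 < C ∧ WPA1 μ fun n =>
      {ω | ((Shat n ω).card : ℝ) ≤ M * s n →
        fitMSE (fun i => R n (Z n i ω).1) (π n ω) (γhat n ω) t
            ≤ C * (penalty xbar δ T n (p n) ^ 2 * s n + b n ^ 2) ∧
          ∑ j, |γhat n ω t j - γstar n t j|
            ≤ C * (penalty xbar δ T n (p n) * s n + b n * Real.sqrt (s n))} := by
    intro M hM
    -- The extra 1 accounts for the support of `γstar`, joined to `Shat`.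
    obtain ⟨c, hc, heig⟩ := hmin (M + 1) (by linarith)
    obtain ⟨η, C, hη, hC, hest⟩ := exists_refit_error_le hT hxbar.le hpmin hM.le hc
    refine ⟨C, hC, ((hreg.inter heig).inter hsel).mono ?_⟩
    filter_upwards [hlampos, hrate.eventually (gt_mem_nhds hη)] with n hlamn hηn
    rintro ω ⟨⟨hregω, heigω⟩, hselω⟩ hcardω
    obtain ⟨h1, h2⟩ := hest hregω (hs n) hlamn.le (hγtilde n ω) hselω.1 hselω.2 hcardω heigω
      hηn.le
    exact ⟨h1 t, (row_le_absSum (γhat n ω - γstar n) t).trans h2⟩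
  set B := 8 * xbar ^ 2 * T with hB
  have hB0 : 0 < B := by positivity
  refine ⟨hShat.of_bound fun M hM => ?_, hShat.of_bound fun M hM => ?_⟩
  · obtain ⟨C, hC, hE⟩ := key M hM
    refine ⟨C * (B + 1), by positivity, hE.mono ?_⟩
    filter_upwards [hpen] with n hpn ω hω hcardω
    rw [Nat.abs_cast] at hcardω
    have h1 := (hω hcardω).1
    change |fitMSE (fun i => R n (Z n i ω).1) (π n ω) (γhat n ω) t| ≤ _
    rw [abs_of_nonneg (fitMSE_nonneg _ _ _ _), mul_assoc C]
    refine h1.trans (mul_le_mul_of_nonneg_left ?_ hC.le)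
    have h2 := mul_le_mul_of_nonneg_right hpn (Nat.cast_nonneg (s n) : (0 : ℝ) ≤ s n)
    have h3 : 0 ≤ (n : ℝ)⁻¹ * s n * Real.log (max (p n) n : ℕ) ^ (3 / 2 + δ) := by
      have := Real.rpow_nonneg (Real.log_natCast_nonneg (max (p n) n)) (3 / 2 + δ)
      positivity
    nlinarith [mul_nonneg hB0.le (sq_nonneg (b n))]
  · obtain ⟨C, hC, hE⟩ := key M hM
    refine ⟨C * (Real.sqrt B + 1), by positivity, hE.mono ?_⟩
    filter_upwards [hpen, hlampos, hb0] with n hpn hlamn hbn ω hω hcardω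
    rw [Nat.abs_cast] at hcardω
    have h1 := (hω hcardω).2
    change abs (∑ j, |γhat n ω t j - γstar n t j|) ≤ _
    rw [abs_of_nonneg (Finset.sum_nonneg fun _ _ => abs_nonneg _), mul_assoc C]
    refine h1.trans (mul_le_mul_of_nonneg_left ?_ hC.le)
    set W := (n : ℝ)⁻¹ * (s n : ℝ) ^ 2 * Real.log (max (p n) n : ℕ) ^ (3 / 2 + δ) with hW
    have h2 : penalty xbar δ T n (p n) * s n ≤ Real.sqrt B * Real.sqrt W := by
      rw [← Real.sqrt_mul hB0.le]
      refine Real.le_sqrt_of_sq_le ?_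
      rw [mul_pow]
      calc _ ≤ _ := mul_le_mul_of_nonneg_right hpn (sq_nonneg (s n : ℝ))
        _ = _ := by rw [hW]; ring
    have h3 : 0 ≤ Real.sqrt B * (b n * Real.sqrt (s n)) := by positivity
    have h4 := Real.sqrt_nonneg W
    rw [add_mul, one_mul, mul_add]
    linarith
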